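/- Let $p\ge 5$ be a prime and let $G$ be a primitive permutation group on a set $\Omega$ with $|\Omega|=3p$. Suppose that the complex permutation character $\pi$ of $G$ on $\Omega$ decomposes as $\pi=1_G+\chi_1+\chi_2+\chi_3$, where $1_G$ is the principal character and $\chi_1,\chi_2,\chi_3$ are irreducible complex characters of $G$ of degrees $p+1$, $p-1$, $p-1$ respectively, with $\chi_2\ne\chi_3$. Then $p\in\{7,19,31\}$. Moreover, the subdegrees of $G$, that is, the lengths of the orbits on $\Omega$ of the stabilizer in $G$ of a point of $\Omega$ (counted with multiplicity), are $1,4,8,8$ if $p=7$; they are $1,6,20,30$ if $p=19$; and they are $1,20,32,40$ if $p=31$. -/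

import Mathlib

/-- `χ : G → ℂ` is the character of an irreducible complex representation of degree `d`
(every `d`-dimensional representation has a model on `ℂᵈ`). -/
def IsIrreducibleCharacter {G : Type*} [Group G] (d : ℕ) (χ : G → ℂ) : Prop :=
  ∃ ρ : Representation ℂ G (Fin d → ℂ), ρ.IsIrreducible ∧ ρ.character = χ

/-- The permutation character of `G` on `Ω`: the character of the complex permutation
representation of `G` on the vector space with basis `Ω`. -/
noncomputable def permutationCharacter (G Ω : Type*) [Group G] [MulAction G Ω] : G → ℂ :=
  (Representation.ofMulAction ℂ G Ω).character

/-- The permutation group `G` on `Ω` is of Type VII with respect to `p`: its permutation character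
is `1 + χ₁ + χ₂ + χ₃`, where the `χᵢ` are irreducible of degrees `p + 1`, `p - 1`, `p - 1`, and
`χ₂ ≠ χ₃`. The summand `1` is the principal character. -/
def IsTypeVII (p : ℕ) (G Ω : Type*) [Group G] [MulAction G Ω] : Prop :=
  ∃ χ₁ χ₂ χ₃ : G → ℂ,
    IsIrreducibleCharacter (p + 1) χ₁ ∧
    IsIrreducibleCharacter (p - 1) χ₂ ∧
    IsIrreducibleCharacter (p - 1) χ₃ ∧
    χ₂ ≠ χ₃ ∧
    ∀ g : G, permutationCharacter G Ω g = 1 + χ₁ g + χ₂ g + χ₃ g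

/-- The multiset of lengths of the orbits on `Ω` of the stabilizer of `ω` in `G`. For a transitive
group these are the subdegrees, and they do not depend on `ω`. -/
noncomputable def subdegrees (G : Type*) {Ω : Type*} [Group G] [MulAction G Ω] [Finite Ω]
    (ω : Ω) : Multiset ℕ :=
  letI := Fintype.ofFinite (MulAction.orbitRel.Quotient (MulAction.stabilizer G ω) Ω)
  (Finset.univ : Finset (MulAction.orbitRel.Quotient (MulAction.stabilizer G ω) Ω)).val.map
    fun q => q.orbit.ncard

/-! The permutation character is multiplicity free with four constituents, so the invariant matrices
form an algebra isomorphic to `ℂ⁴` and there are four orbitals. The matrix `A` of a nontrivial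
orbital has eigenvalues `k` (the subdegree), `a`, `b`, `b'` of multiplicities `1`, `p + 1`, `p - 1`,
`p - 1`. Algebraic conjugates have equal multiplicity, which forces `a` to be an integer
(`exists_int_eq_of_map_eq_prod`) and makes the projection `E` of rank `p + 1` rational
(`exists_rational_projection`).

The group contains an element `g` acting as three `p`-cycles (`exists_pow_eq_one_and_smul_ne`). On
the image of `E` it fixes at most a plane, and the rest has dimension divisible by `p - 1`; hence
the image contains every `g`-invariant function of sum zero (`mulVec_eq_self_of_smul_eq`). Applying
`A` to a difference of two cycle indicators gives `a = d - e` and `k = d + 2 * e`, where the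
suborbit of `x` meets the cycle of `x` in `d` points and each other cycle in `e` points.

The traces of `A` and `A Aᴴ` make `b + b'` and `T = |b - b'|²` integers. The trace of `A²` shows
that `(b - b')²` is real, and the three differences `b - b'` sum to zero. They therefore lie on one
axis, and the `T`s satisfy the quadratic relation between the squares of three real numbers with sum
zero.

With `n = p - 1` and `f = e - d`, the trace equation reads `3 * d = n * m`, and everything is a
function of `n`, `m`, `f`. The nonnegative `m`s sum to `3` and the `f`s to `1`. The pattern `3, 0,
0` is impossible, `2, 1, 0` gives `n = 6` or `18`, and `1, 1, 1` gives `n = 30`. -/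

/-! ### Diophantine analysis of the orbital data -/

/-- The numerical data attached to a nontrivial orbital in terms of `n = p - 1`: the subdegree is
`n * m + 2 * f`, and `T` is the squared distance between the two eigenvalues of multiplicity
`p - 1`. -/
structure OrbitalData (n m f G T : ℤ) : Prop where
  m_nonneg : 0 ≤ m
  three_dvd : 3 ∣ n * m
  mul_eq : n * G = 6 * (f * (f - 1))
  T_eq : T = 2 * m * (3 - m) * n + m * (6 - m) + (12 - 6 * m) * f - 3 * f ^ 2 - 2 * G
  T_nonneg : 0 ≤ T
  pos : 0 < n * m + 2 * f

theorem Int.mul_sub_one_self_nonneg (f : ℤ) : 0 ≤ f * (f - 1) := by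
  rcases le_or_gt f 0 with h | h
  · nlinarith
  · exact mul_nonneg h.le (by omega)

theorem OrbitalData.G_nonneg {n m f G T : ℤ} (h : OrbitalData n m f G T) (hn : 0 < n) : 0 ≤ G := by
  have := h.mul_eq
  have := Int.mul_sub_one_self_nonneg f
  by_contra hG
  nlinarith

/-- For `m = 0`, `T = 3 * f * (4 - f) - 2 * G`, and `G` is positive once `f ≥ 2`; so `T ≥ 0`
excludes `f ≥ 4`. -/
theorem OrbitalData.f_bounds_of_m_eq_zero {n f G T : ℤ} (h : OrbitalData n 0 f G T) (hn : 0 < n) :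
    1 ≤ f ∧ f ≤ 3 := by
  have h1 := h.pos
  have h2 := h.T_eq
  have h3 := h.T_nonneg
  have h4 := h.G_nonneg hn
  have h5 := h.mul_eq
  have hf : 1 ≤ f := by linarith
  refine ⟨hf, ?_⟩
  by_contra hc
  have hc : 4 ≤ f := by omega
  have : 0 < G := by
    by_contra hG
    have : G = 0 := by omega
    subst this
    nlinarith
  nlinarith

theorem not_orbitalData_three_zero_zero {n f₁ f₂ f₃ G₁ G₂ G₃ T₁ T₂ T₃ : ℤ} (hn : 4 ≤ n)
    (h₁ : OrbitalData n 3 f₁ G₁ T₁) (h₂ : OrbitalData n 0 f₂ G₂ T₂) (h₃ : OrbitalData n 0 f₃ G₃ T₃)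
    (hf : f₁ + f₂ + f₃ = 1)
    (hT : T₁ ^ 2 + T₂ ^ 2 + T₃ ^ 2 = 2 * (T₁ * T₂ + T₂ * T₃ + T₃ * T₁)) : False := by
  obtain ⟨a2, b2⟩ := h₂.f_bounds_of_m_eq_zero (by omega)
  obtain ⟨a3, b3⟩ := h₃.f_bounds_of_m_eq_zero (by omega)
  have g1 := h₁.G_nonneg (by omega)
  have e1 := h₁.mul_eq
  have e2 := h₂.mul_eq
  have e3 := h₃.mul_eq
  have t1 := h₁.T_eq
  have t2 := h₂.T_eq
  have t3 := h₃.T_eq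
  have n1 := h₁.T_nonneg
  have n2 := h₂.T_nonneg
  have n3 := h₃.T_nonneg
  have hf1 : f₁ = 1 - f₂ - f₃ := by omega
  subst hf1
  -- For `m = 3`, `T₁ = 12 - 3 * (f₁ + 1) ^ 2 - 2 * G₁`, so `T₁ ≥ 0` gives `f₁ ≥ -3`.
  have hsmall : f₂ + f₃ ≤ 4 := by nlinarith
  have key : (f₂ = 1 ∧ f₃ = 1) ∨ (f₂ = 1 ∧ f₃ = 2) ∨ (f₂ = 2 ∧ f₃ = 1) ∨ f₂ + f₃ = 4 := by omega
  rcases key with ⟨rfl, rfl⟩ | ⟨rfl, rfl⟩ | ⟨rfl, rfl⟩ | h4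
  · have hG2 : G₂ = 0 := by nlinarith
    have hG3 : G₃ = 0 := by nlinarith
    have hG : n * G₁ = 12 := by linarith
    have hT1 : T₁ = 12 - 2 * G₁ := by rw [t1]; ring
    have hT2 : T₂ = 9 := by rw [t2, hG2]; norm_num
    have hT3 : T₃ = 9 := by rw [t3, hG3]; norm_num
    rw [hT1, hT2, hT3] at hT
    have : (12 - 2 * G₁) * (12 - 2 * G₁ - 36) = 0 := by linear_combination hT
    rcases mul_eq_zero.mp this with h | h
    · obtain rfl : G₁ = 6 := by omega
      omega
    · omega
  · have hG2 : G₂ = 0 := by nlinarith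
    have hG3 : 0 < G₃ := by nlinarith
    have hG : n * (G₁ - 3 * G₃) = 0 := by linarith
    have hG : G₁ = 3 * G₃ := by
      rcases mul_eq_zero.mp hG with h | h <;> omega
    have hT2 : T₂ = 9 := by rw [t2, hG2]; norm_num
    obtain rfl : G₃ = 1 := by omega
    obtain rfl : T₁ = 3 := by omega
    obtain rfl : T₃ = 10 := by omega
    norm_num [hT2] at hT
  · have hG3 : G₃ = 0 := by nlinarith
    have hG2 : 0 < G₂ := by nlinarith
    have hG : n * (G₁ - 3 * G₂) = 0 := by linarith
    have hG : G₁ = 3 * G₂ := by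
      rcases mul_eq_zero.mp hG with h | h <;> omega
    have hT3 : T₃ = 9 := by rw [t3, hG3]; norm_num
    obtain rfl : G₂ = 1 := by omega
    obtain rfl : T₁ = 3 := by omega
    obtain rfl : T₂ = 10 := by omega
    norm_num [hT3] at hT
  · rw [show 1 - f₂ - f₃ = -3 by omega] at t1 e1
    have : 0 < G₁ := by nlinarith
    omega

/-- By `nw`, `x` and `w` have the same sign and `4 * |x| ≥ 6 * |w|`, so for `|w| ≥ 2` the cubic
terms outweigh the rest. For `w = ±1` the equation factors and leaves `n = 8` or `n = 16`, neither
divisible by `3`. -/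
theorem cubic_ne {n x w : ℤ} (hn : 6 ≤ n) (h3 : 3 ∣ n) (hw : w ≠ 0) (nw : n * w = 4 * x)
    (h : w * (4 * x ^ 2 + w ^ 2 + 5 * (x * w) + 4 * x + w - 4) = 16 * x) : False := by
  rcases lt_or_gt_of_ne hw with hneg | hpos
  · obtain ⟨v, rfl⟩ : ∃ v, w = -v := ⟨-w, by ring⟩
    obtain ⟨u, rfl⟩ : ∃ u, x = -u := ⟨-x, by ring⟩
    have hv : 1 ≤ v := by omega
    have huv : 6 * v ≤ 4 * u := by nlinarith
    rcases eq_or_ne v 1 with rfl | hv1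
    · have : (4 * u + 1) * (u - 4) = 0 := by linarith
      rcases mul_eq_zero.mp this with h | h <;> omega
    · have h2 : 2 ≤ v := by omega
      have hu3 : 3 ≤ u := by omega
      have p1 : 0 ≤ (u - 3) * (u * v) := mul_nonneg (by omega) (by positivity)
      have p2 : 0 ≤ (v - 2) * u := mul_nonneg (by omega) (by omega)
      have p3 : 0 ≤ (u - 3) * (v * v) := mul_nonneg (by omega) (by positivity)
      have p4 : 0 < v ^ 3 := by positivity
      have p5 : 0 ≤ (v - 2) * v := mul_nonneg (by omega) (by omega)
      have : v * (4 * u ^ 2 + v ^ 2 + 5 * (u * v) - 4 * u - v - 4) = 16 * u := by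
        linear_combination -h
      have : 4 * ((u - 3) * (u * v)) + 8 * ((v - 2) * u) + 5 * ((u - 3) * (v * v)) + v ^ 3 +
          14 * ((v - 2) * v) + 24 * v = 0 := by linear_combination this
      omega
  · have huv : 6 * w ≤ 4 * x := by nlinarith
    rcases eq_or_ne w 1 with rfl | hv1
    · have : (4 * x + 1) * (x - 2) = 0 := by linarith
      rcases mul_eq_zero.mp this with h | h <;> omega
    · have h2 : 2 ≤ w := by omega
      have hu3 : 3 ≤ x := by omega
      have p1 : 0 ≤ (x - 3) * (x * w) := mul_nonneg (by omega) (by positivity)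
      have p2 : 0 ≤ (w - 2) * x := mul_nonneg (by omega) (by omega)
      have p3 : 0 ≤ (x - 3) * (w * w) := mul_nonneg (by omega) (by positivity)
      have p4 : 0 < w ^ 3 := by positivity
      have p5 : 0 ≤ (w - 2) * w := mul_nonneg (by omega) (by omega)
      have : 4 * ((x - 3) * (x * w)) + 16 * ((w - 2) * x) + 5 * ((x - 3) * (w * w)) + w ^ 3 +
          16 * ((w - 2) * w) + 28 * w + 16 * x = 0 := by linear_combination h
      omega

/-- Here `n * G₃ = 0` puts no bound on `n`, so a finite search is not available. Since `T₃ = 9`, the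
relation `hT` says that `36 * T₂` is a square; with `G₂ - G₁ = 3 * w` it becomes `T₂ = (x + w - 1) ^
2`, and eliminating `G₂` and `n` leads to `cubic_ne`. -/
theorem not_orbitalData_two_one_zero_of_f_eq_one {n f₁ f₂ G₁ G₂ G₃ T₁ T₂ T₃ : ℤ} (hn : 4 ≤ n)
    (h₁ : OrbitalData n 2 f₁ G₁ T₁) (h₂ : OrbitalData n 1 f₂ G₂ T₂) (h₃ : OrbitalData n 0 1 G₃ T₃)
    (hf : f₁ + f₂ = 0)
    (hT : T₁ ^ 2 + T₂ ^ 2 + T₃ ^ 2 = 2 * (T₁ * T₂ + T₂ * T₃ + T₃ * T₁)) : False := by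
  have h3n : 3 ∣ n := by simpa using h₂.three_dvd
  obtain rfl : f₂ = -f₁ := by omega
  have e1 := h₁.mul_eq
  have e2 := h₂.mul_eq
  have e3 := h₃.mul_eq
  have t1 := h₁.T_eq
  have t2 := h₂.T_eq
  have t3 := h₃.T_eq
  set x := f₁
  have g3 : G₃ = 0 := by nlinarith
  have ny : n * (G₂ - G₁) = 12 * x := by linarith
  have k : (T₁ - T₂ - 9) ^ 2 = 36 * T₂ := by
    have : T₃ = 9 := by rw [t3, g3]; norm_num
    rw [this] at hT
    linear_combination hT
  have k2 : (3 * x + (G₂ - G₁) - 3) ^ 2 = 9 * T₂ := by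
    have : T₁ - T₂ - 9 = 2 * (3 * x + (G₂ - G₁) - 3) := by rw [t1, t2]; ring
    rw [this] at k
    linarith
  have h3 : (3 : ℤ) ∣ G₂ - G₁ := by
    have : (3 : ℤ) ∣ (3 * x + (G₂ - G₁) - 3) := by
      apply Int.prime_three.dvd_of_dvd_pow (n := 2)
      exact ⟨3 * T₂, by rw [k2]; ring⟩
    omega
  obtain ⟨w, hw⟩ := h3
  have nw : n * w = 4 * x := by
    rw [hw] at ny
    linarith
  have k3 : (x + w - 1) ^ 2 = T₂ := by
    rw [hw] at k2
    have : (3 * x + 3 * w - 3) ^ 2 = 9 * (x + w - 1) ^ 2 := by ring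
    linarith
  rcases eq_or_ne x 0 with hx | hx
  · have : w = 0 := by
      have : n * w = 0 := by rw [nw, hx]; rfl
      rcases mul_eq_zero.mp this with h | h <;> omega
    have hG2 : G₂ = 0 := by
      rw [hx] at e2
      have : n * G₂ = 0 := by rw [e2]; rfl
      rcases mul_eq_zero.mp this with h | h <;> omega
    rw [t2, hx, this, hG2] at k3
    linarith
  have hG2 : 2 * G₂ = 3 * (x + 1) * w := by
    have : 2 * x * (2 * G₂) = 2 * x * (3 * (x + 1) * w) := by
      linear_combination (-G₂) * nw + w * e2
    exact mul_left_cancel₀ (by omega) this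
  have k4 : 4 * x ^ 2 + w ^ 2 + 5 * (x * w) + 4 * x + w - 4 = 4 * n := by
    rw [t2] at k3
    linear_combination k3 - hG2
  have k5 : w * (4 * x ^ 2 + w ^ 2 + 5 * (x * w) + 4 * x + w - 4) = 16 * x := by
    rw [k4]; linarith
  have hw0 : w ≠ 0 := by
    rintro rfl
    omega
  exact cubic_ne (by omega) h3n hw0 nw k5

theorem two_one_zero_search : ∀ D ∈ ({2, 3, 4, 6, 12} : Finset ℤ),
    ∀ x ∈ ({-7, -6, -5, -4, -3, -2, -1, 0, 1, 2, 3, 4, 5, 6, 7} : Finset ℤ),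
    ∀ w ∈ ({2, 3} : Finset ℤ),
    let G₁ := 6 * (x * (x - 1)) / (3 * D)
    let z := 1 - w - x
    let G₂ := 6 * (z * (z - 1)) / (3 * D)
    let G₃ := 6 * (w * (w - 1)) / (3 * D)
    let T₁ := 12 * D + 8 - 3 * x ^ 2 - 2 * G₁
    let T₂ := 12 * D + 5 + 6 * z - 3 * z ^ 2 - 2 * G₂
    let T₃ := 12 * w - 3 * w ^ 2 - 2 * G₃
    3 * D * G₁ = 6 * (x * (x - 1)) → 3 * D * G₂ = 6 * (z * (z - 1)) →
    3 * D * G₃ = 6 * (w * (w - 1)) → 0 ≤ T₃ →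
    T₁ ^ 2 + T₂ ^ 2 + T₃ ^ 2 = 2 * (T₁ * T₂ + T₂ * T₃ + T₃ * T₁) → 0 < 3 * D + 2 * z →
    (D = 2 ∧ x = -2 ∧ w = 2) ∨ (D = 6 ∧ x = -3 ∧ w = 3) := by
  decide +kernel

theorem orbitalData_two_one_zero {n f₁ f₂ f₃ G₁ G₂ G₃ T₁ T₂ T₃ : ℤ} (hn : 4 ≤ n)
    (h₁ : OrbitalData n 2 f₁ G₁ T₁) (h₂ : OrbitalData n 1 f₂ G₂ T₂) (h₃ : OrbitalData n 0 f₃ G₃ T₃)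
    (hf : f₁ + f₂ + f₃ = 1)
    (hT : T₁ ^ 2 + T₂ ^ 2 + T₃ ^ 2 = 2 * (T₁ * T₂ + T₂ * T₃ + T₃ * T₁)) :
    (n = 6 ∧ f₁ = -2 ∧ f₂ = 1 ∧ f₃ = 2) ∨ (n = 18 ∧ f₁ = -3 ∧ f₂ = 1 ∧ f₃ = 3) := by
  obtain ⟨a3, b3⟩ := h₃.f_bounds_of_m_eq_zero (by omega)
  obtain ⟨D, rfl⟩ : 3 ∣ n := by simpa using h₂.three_dvd
  rcases eq_or_ne f₃ 1 with rfl | hf3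
  · exact (not_orbitalData_two_one_zero_of_f_eq_one hn h₁ h₂ h₃ (by omega) hT).elim
  have t1 := h₁.T_eq
  have t2 := h₂.T_eq
  have t3 := h₃.T_eq
  have g1 := h₁.G_nonneg (by omega)
  have n1 := h₁.T_nonneg
  have n3 := h₃.T_nonneg
  obtain rfl : f₂ = 1 - f₃ - f₁ := by omega
  -- For `f₃ = 2` or `3`, `mul_eq` reads `D * G₃ = 4` or `12`; and `n ≥ 4` excludes `D = 1`.
  have hD : D ∈ ({2, 3, 4, 6, 12} : Finset ℤ) := by
    have e3 := h₃.mul_eq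
    have hw : f₃ = 2 ∨ f₃ = 3 := by omega
    have hdvd : D ∣ 12 := by
      rcases hw with rfl | rfl
      · exact ⟨3 * G₃, by linarith⟩
      · exact ⟨G₃, by linarith⟩
    have := Int.le_of_dvd (by norm_num) hdvd
    have : 2 ≤ D := by omega
    interval_cases D <;> first | decide | (exfalso; revert hdvd; decide)
  have hD12 : D ≤ 12 := by
    simp only [Finset.mem_insert, Finset.mem_singleton] at hD
    omega
  -- `T₁ ≥ 0` gives `3 * f₁ ^ 2 ≤ 12 * D + 8 ≤ 152`.
  have hx : f₁ ∈ ({-7, -6, -5, -4, -3, -2, -1, 0, 1, 2, 3, 4, 5, 6, 7} : Finset ℤ) := by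
    have h1 : f₁ ≤ 7 := by nlinarith
    have h2 : -7 ≤ f₁ := by nlinarith
    simp only [Finset.mem_insert, Finset.mem_singleton]
    omega
  have hdiv : ∀ {f G : ℤ}, 3 * D * G = 6 * (f * (f - 1)) → 6 * (f * (f - 1)) / (3 * D) = G :=
    fun h => by rw [← h]; exact Int.mul_ediv_cancel_left _ (by omega)
  have key := two_one_zero_search D hD f₁ hx f₃
    (by simp only [Finset.mem_insert, Finset.mem_singleton]; omega)
  simp only [hdiv h₁.mul_eq, hdiv h₂.mul_eq, hdiv h₃.mul_eq] at key
  have t1' : T₁ = 12 * D + 8 - 3 * f₁ ^ 2 - 2 * G₁ := by rw [t1]; ring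
  have t2' : T₂ = 12 * D + 5 + 6 * (1 - f₃ - f₁) - 3 * (1 - f₃ - f₁) ^ 2 - 2 * G₂ := by
    rw [t2]; ring
  have t3' : T₃ = 12 * f₃ - 3 * f₃ ^ 2 - 2 * G₃ := by rw [t3]; ring
  rw [← t1', ← t2', ← t3'] at key
  have := key h₁.mul_eq h₂.mul_eq h₃.mul_eq n3 hT (by linarith [h₂.pos])
  omega

/-- Eliminating `f ^ 2` turns the inequality into `(3 * D + 4) * G ≤ 24 * D + 10 + 6 * f`. If `G ≥
9`, this forces `6 * f ≥ 3 * D + 26`, and for `f` that large the value `G = 2 * f * (f - 1) / D`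
breaks the same inequality. -/
theorem G_le_eight {D f G : ℤ} (hD : 2 ≤ D) (hG : D * G = 2 * (f * (f - 1)))
    (hT : 0 ≤ 12 * D + 5 + 6 * f - 3 * f ^ 2 - 2 * G) : G ≤ 8 := by
  by_contra hc
  have hc : 9 ≤ G := by omega
  have h1 : 0 ≤ 24 * D + 10 + 6 * f - (3 * D + 4) * G := by linarith
  have h2 : 0 ≤ (3 * D + 4) * (G - 9) := mul_nonneg (by omega) (by omega)
  have h3 : 3 * D + 26 ≤ 6 * f := by linarith
  have h4 : 0 ≤ (2 * f - D) * D := mul_nonneg (by omega) (by omega)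
  have h5 : 0 ≤ D * (24 * D + 10 + 6 * f - (3 * D + 4) * G) := mul_nonneg (by omega) h1
  have h6 : D * (24 * D + 10 + 6 * f) - (3 * D + 4) * (2 * (f * (f - 1))) ≥ 0 := by
    rw [← hG]; linarith
  have h7 : 0 ≤ D * (6 * f - 3 * D - 26) := mul_nonneg (by omega) (by omega)
  have h8 : 0 ≤ f * (f - 1) := Int.mul_sub_one_self_nonneg f
  have h9 : 0 ≤ D * (f - 9) * (f - 9) := by
    rw [mul_assoc]; exact mul_nonneg (by omega) (mul_self_nonneg _)
  nlinarith

/-- If one `f` vanishes, the other two are `f` and `1 - f` and share the same `g`. Eliminating `f`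
from the relation between the `T`s leaves a quadratic in `D` for each `g`, without admissible roots.
-/
theorem tri_ne_of_f_eq_zero {D f g : ℤ} (hD : 2 ≤ D) (hg : 0 ≤ g) (hg8 : g ≤ 8)
    (hG : D * g = 2 * (f * (f - 1)))
    (hT : (12 * D + 5) ^ 2 - 2 * (12 * D + 5) * ((12 * D + 5 + 6 * f - 3 * f ^ 2 - 2 * g) +
      (12 * D + 5 + 6 * (1 - f) - 3 * (1 - f) ^ 2 - 2 * g)) +
      ((12 * D + 5 + 6 * f - 3 * f ^ 2 - 2 * g) -
      (12 * D + 5 + 6 * (1 - f) - 3 * (1 - f) ^ 2 - 2 * g)) ^ 2 = 0) : False := by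
  have key : (12 * D + 5) * (-36 * D - 21 + (6 * D + 8) * g) + 18 * (g * D) + 9 = 0 := by
    linear_combination hT + (18 + 6 * (12 * D + 5)) * hG
  interval_cases g
  all_goals ring_nf at key
  all_goals omega

/-- The bound on the `g`s leaves `9³` triples, and each triple determines `D` and the `f`s: the
quotients are the solutions of `discriminant_mul_eq` combined with `D * g₁ = 2 * (f₁ * (f₁ - 1))`.
-/
theorem one_one_one_search : ∀ g₁ ∈ ({0, 1, 2, 3, 4, 5, 6, 7, 8} : Finset ℤ),
    ∀ g₂ ∈ ({0, 1, 2, 3, 4, 5, 6, 7, 8} : Finset ℤ),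
    ∀ g₃ ∈ ({0, 1, 2, 3, 4, 5, 6, 7, 8} : Finset ℤ),
    let h₁ := g₁ - g₂ - g₃
    let h₂ := g₂ - g₁ - g₃
    let h₃ := g₃ - g₁ - g₂
    let Δ := 4 * g₂ * g₃ - h₁ ^ 2
    let D := (8 * g₁ * h₁ ^ 2 + 4 * h₁ * Δ) / Δ ^ 2
    let f₁ := Δ * D / (4 * h₁)
    let f₂ := Δ * D / (4 * h₂)
    let f₃ := Δ * D / (4 * h₃)
    let T₁ := 12 * D + 5 + 6 * f₁ - 3 * f₁ ^ 2 - 2 * g₁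
    let T₂ := 12 * D + 5 + 6 * f₂ - 3 * f₂ ^ 2 - 2 * g₂
    let T₃ := 12 * D + 5 + 6 * f₃ - 3 * f₃ ^ 2 - 2 * g₃
    Δ ≠ 0 → Δ ^ 2 * D = 8 * g₁ * h₁ ^ 2 + 4 * h₁ * Δ → 2 ≤ D → f₁ + f₂ + f₃ = 1 →
    D * g₁ = 2 * (f₁ * (f₁ - 1)) → D * g₂ = 2 * (f₂ * (f₂ - 1)) → D * g₃ = 2 * (f₃ * (f₃ - 1)) →
    T₁ ^ 2 + T₂ ^ 2 + T₃ ^ 2 = 2 * (T₁ * T₂ + T₂ * T₃ + T₃ * T₁) →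
    D = 10 ∧ ({f₁, f₂, f₃} : Multiset ℤ) = {-5, 1, 5} := by
  decide +kernel

/-- From `f₁ = 1 - f₂ - f₃` one gets `D * (g₁ - g₂ - g₃) = 4 * f₂ * f₃`; squaring and comparing with
`D * g₂ * (D * g₃)` isolates `f₁`. The factor multiplying `D` on the left is symmetric in the three
`g`s. -/
theorem discriminant_mul_eq {D f₁ f₂ f₃ g₁ g₂ g₃ : ℤ} (hD : D ≠ 0) (hf : f₁ + f₂ + f₃ = 1)
    (e₁ : D * g₁ = 2 * (f₁ * (f₁ - 1))) (e₂ : D * g₂ = 2 * (f₂ * (f₂ - 1)))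
    (e₃ : D * g₃ = 2 * (f₃ * (f₃ - 1))) :
    (4 * g₂ * g₃ - (g₁ - g₂ - g₃) ^ 2) * D = 4 * (g₁ - g₂ - g₃) * f₁ := by
  obtain rfl : f₁ = 1 - f₂ - f₃ := by omega
  have h : D * (g₁ - g₂ - g₃) = 4 * (f₂ * f₃) := by linear_combination e₁ - e₂ - e₃
  apply mul_left_cancel₀ hD
  calc D * ((4 * g₂ * g₃ - (g₁ - g₂ - g₃) ^ 2) * D)
      = 4 * (D * g₂) * (D * g₃) - (D * (g₁ - g₂ - g₃)) ^ 2 := by ring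
    _ = 4 * (D * (g₁ - g₂ - g₃)) * (1 - f₂ - f₃) := by rw [e₂, e₃, h]; ring
    _ = _ := by ring

theorem orbitalData_one_one_one {n f₁ f₂ f₃ G₁ G₂ G₃ T₁ T₂ T₃ : ℤ} (hn : 4 ≤ n)
    (h₁ : OrbitalData n 1 f₁ G₁ T₁) (h₂ : OrbitalData n 1 f₂ G₂ T₂) (h₃ : OrbitalData n 1 f₃ G₃ T₃)
    (hf : f₁ + f₂ + f₃ = 1)
    (hT : T₁ ^ 2 + T₂ ^ 2 + T₃ ^ 2 = 2 * (T₁ * T₂ + T₂ * T₃ + T₃ * T₁)) :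
    n = 30 ∧ ({f₁, f₂, f₃} : Multiset ℤ) = {-5, 1, 5} := by
  obtain ⟨D, rfl⟩ : 3 ∣ n := by simpa using h₂.three_dvd
  have hD : 2 ≤ D := by omega
  have ev : ∀ {f G T : ℤ}, OrbitalData (3 * D) 1 f G T → D * G = 2 * (f * (f - 1)) ∧
      T = 12 * D + 5 + 6 * f - 3 * f ^ 2 - 2 * G ∧
      G ∈ ({0, 1, 2, 3, 4, 5, 6, 7, 8} : Finset ℤ) := by
    intro f G T h
    have h1 : D * G = 2 * (f * (f - 1)) := by linarith [h.mul_eq]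
    have h2 : T = 12 * D + 5 + 6 * f - 3 * f ^ 2 - 2 * G := by rw [h.T_eq]; ring
    have h3 := G_le_eight hD h1 (h2 ▸ h.T_nonneg)
    have h4 := h.G_nonneg (by omega)
    refine ⟨h1, h2, ?_⟩
    simp only [Finset.mem_insert, Finset.mem_singleton]
    omega
  obtain ⟨e1, t1, r1⟩ := ev h₁
  obtain ⟨e2, t2, r2⟩ := ev h₂
  obtain ⟨e3, t3, r3⟩ := ev h₃
  have d1 := discriminant_mul_eq (by omega) hf e1 e2 e3
  have d2 := discriminant_mul_eq (by omega) (show f₂ + f₁ + f₃ = 1 by omega) e2 e1 e3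
  have d3 := discriminant_mul_eq (by omega) (show f₃ + f₁ + f₂ = 1 by omega) e3 e1 e2
  have q2 : 4 * G₁ * G₃ - (G₂ - G₁ - G₃) ^ 2 = 4 * G₂ * G₃ - (G₁ - G₂ - G₃) ^ 2 := by ring
  have q3 : 4 * G₁ * G₂ - (G₃ - G₁ - G₂) ^ 2 = 4 * G₂ * G₃ - (G₁ - G₂ - G₃) ^ 2 := by ring
  rw [q2] at d2
  rw [q3] at d3
  have bd : ∀ {G : ℤ}, G ∈ ({0, 1, 2, 3, 4, 5, 6, 7, 8} : Finset ℤ) → 0 ≤ G ∧ G ≤ 8 := by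
    intro G h
    simp only [Finset.mem_insert, Finset.mem_singleton] at h
    omega
  have hne1 : f₁ ≠ 0 := by
    rintro rfl
    obtain rfl : f₃ = 1 - f₂ := by omega
    have : D * (G₃ - G₂) = 0 := by linear_combination e3 - e2
    obtain rfl : G₃ = G₂ := by rcases mul_eq_zero.mp this with h | h <;> omega
    obtain rfl : G₁ = 0 := by rcases mul_eq_zero.mp (e1.trans (by ring)) with h | h <;> omega
    refine tri_ne_of_f_eq_zero hD (bd r2).1 (bd r2).2 e2 ?_
    rw [t1, t2, t3] at hT
    linear_combination hT
  have hne2 : f₂ ≠ 0 := by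
    rintro rfl
    obtain rfl : f₃ = 1 - f₁ := by omega
    have : D * (G₃ - G₁) = 0 := by linear_combination e3 - e1
    obtain rfl : G₃ = G₁ := by rcases mul_eq_zero.mp this with h | h <;> omega
    obtain rfl : G₂ = 0 := by rcases mul_eq_zero.mp (e2.trans (by ring)) with h | h <;> omega
    refine tri_ne_of_f_eq_zero hD (bd r1).1 (bd r1).2 e1 ?_
    rw [t1, t2, t3] at hT
    linear_combination hT
  have hne3 : f₃ ≠ 0 := by
    rintro rfl
    obtain rfl : f₂ = 1 - f₁ := by omega
    have : D * (G₂ - G₁) = 0 := by linear_combination e2 - e1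
    obtain rfl : G₂ = G₁ := by rcases mul_eq_zero.mp this with h | h <;> omega
    obtain rfl : G₃ = 0 := by rcases mul_eq_zero.mp (e3.trans (by ring)) with h | h <;> omega
    refine tri_ne_of_f_eq_zero hD (bd r1).1 (bd r1).2 e1 ?_
    rw [t1, t2, t3] at hT
    linear_combination hT
  set Δ := 4 * G₂ * G₃ - (G₁ - G₂ - G₃) ^ 2 with hΔ
  have hΔ0 : Δ ≠ 0 := by
    intro h0
    have hz : D * (G₁ - G₂ - G₃) = 4 * (f₂ * f₃) := by
      obtain rfl : f₁ = 1 - f₂ - f₃ := by omega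
      linear_combination e1 - e2 - e3
    rw [h0, zero_mul] at d1
    have : G₁ - G₂ - G₃ = 0 := by
      rcases mul_eq_zero.mp d1.symm with h | h
      · omega
      · exact absurd h hne1
    rw [this, mul_zero] at hz
    rcases mul_eq_zero.mp hz.symm with h | h
    · omega
    · exact (mul_ne_zero hne2 hne3) h
  have hne : ∀ {h f : ℤ}, Δ * D = 4 * h * f → Δ * D / (4 * h) = f := by
    intro h f e
    rw [e]
    refine Int.mul_ediv_cancel_left _ ?_
    rintro h0
    rw [h0, zero_mul] at e
    exact mul_ne_zero hΔ0 (by omega) e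
  -- Multiply `e1` by `8 * (G₁ - G₂ - G₃) ^ 2`, replace `4 * (G₁ - G₂ - G₃) * f₁` by `Δ * D`, and
  -- cancel `D`.
  have hDeq : Δ ^ 2 * D = 8 * G₁ * (G₁ - G₂ - G₃) ^ 2 + 4 * (G₁ - G₂ - G₃) * Δ := by
    apply mul_left_cancel₀ (show D ≠ 0 by omega)
    linear_combination (Δ * D + 4 * (G₁ - G₂ - G₃) * f₁ - 4 * (G₁ - G₂ - G₃)) * d1 -
      8 * (G₁ - G₂ - G₃) ^ 2 * e1
  have hDdiv : (8 * G₁ * (G₁ - G₂ - G₃) ^ 2 + 4 * (G₁ - G₂ - G₃) * Δ) / Δ ^ 2 = D := by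
    rw [← hDeq]
    exact Int.mul_ediv_cancel_left _ (pow_ne_zero 2 hΔ0)
  have key := one_one_one_search G₁ r1 G₂ r2 G₃ r3
  simp only [← hΔ, hDdiv, hne d1, hne d2, hne d3, ← t1, ← t2, ← t3] at key
  have := key hΔ0 hDeq hD hf e1 e2 e3 hT
  exact ⟨by omega, this.2⟩

/-! ### From the trace equations to the subdegrees -/

theorem orbitalData_of_eqs {n d e s q T : ℤ} (hn : 4 ≤ n) (hd : 0 ≤ d) (hk : 0 < d + 2 * e)
    (hs : (d + 2 * e) + (n + 2) * (d - e) + n * s = 0)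
    (hq : n * q = 3 * (n + 1) * (d + 2 * e) - (d + 2 * e) ^ 2 - (n + 2) * (d - e) ^ 2)
    (hT : T = 2 * q - s ^ 2) (hT0 : 0 ≤ T) :
    ∃ m f G, OrbitalData n m f G T ∧ 3 * d = n * m ∧ e = d + f := by
  have hm : 3 * d = n * (e - d - s) := by linarith
  -- Modulo `n`, and with `k = n * m + 2 * f`, the equation `hq` reads `6 * f * (f - 1) ≡ 0`; the
  -- third witness is the quotient by `n`, written without division.
  refine ⟨e - d - s, e - d, (e - d - s) + 3 * d + 6 * e - (e - d - s) * d - (d - e) ^ 2 - q -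
    2 * (e - d - s) * d - 2 * (e - d - s) * (2 * (e - d) - 1), ⟨?_, ⟨d, hm.symm⟩, ?_, ?_, hT0, ?_⟩,
    hm, by ring⟩
  · by_contra hc
    have : n * (e - d - s) < 0 := mul_neg_of_pos_of_neg (by omega) (by omega)
    omega
  · generalize e - d - s = m at hm ⊢
    linear_combination -hq + (4 * e - d - 3) * hm
  · rw [hT]
    generalize hms : e - d - s = m at hm ⊢
    obtain rfl : s = e - d - m := by omega
    linear_combination (2 * (3 - m)) * hm
  · rw [← hm]; linarith

theorem OrbitalData.subdegrees_eq {n : ℤ} (hn : 4 ≤ n) {m f G T : Fin 3 → ℤ}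
    (h : ∀ i, OrbitalData n (m i) (f i) (G i) (T i)) (hm : ∑ i, m i = 3) (hf : ∑ i, f i = 1)
    (hT : T 0 ^ 2 + T 1 ^ 2 + T 2 ^ 2 = 2 * (T 0 * T 1 + T 1 * T 2 + T 2 * T 0)) :
    let k := fun i => n * m i + 2 * f i
    (n = 6 ∧ ({k 0, k 1, k 2} : Multiset ℤ) = {4, 8, 8}) ∨
    (n = 18 ∧ ({k 0, k 1, k 2} : Multiset ℤ) = {6, 20, 30}) ∨
    (n = 30 ∧ ({k 0, k 1, k 2} : Multiset ℤ) = {20, 32, 40}) := by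
  intro k
  simp only [k]
  rw [Fin.sum_univ_three] at hm hf
  have p0 := (h 0).m_nonneg
  have p1 := (h 1).m_nonneg
  have p2 := (h 2).m_nonneg
  have h0 := h 0
  have h1 := h 1
  have h2 := h 2
  generalize m 0 = m₀, m 1 = m₁, m 2 = m₂, f 0 = f₀, f 1 = f₁, f 2 = f₂, G 0 = G₀, G 1 = G₁,
    G 2 = G₂, T 0 = T₀, T 1 = T₁, T 2 = T₂ at *
  have cases : (m₀ = 1 ∧ m₁ = 1 ∧ m₂ = 1) ∨ (m₀ = 3 ∧ m₁ = 0 ∧ m₂ = 0) ∨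
    (m₀ = 0 ∧ m₁ = 3 ∧ m₂ = 0) ∨ (m₀ = 0 ∧ m₁ = 0 ∧ m₂ = 3) ∨ (m₀ = 2 ∧ m₁ = 1 ∧ m₂ = 0) ∨
    (m₀ = 2 ∧ m₁ = 0 ∧ m₂ = 1) ∨ (m₀ = 1 ∧ m₁ = 2 ∧ m₂ = 0) ∨ (m₀ = 0 ∧ m₁ = 2 ∧ m₂ = 1) ∨
    (m₀ = 1 ∧ m₁ = 0 ∧ m₂ = 2) ∨ (m₀ = 0 ∧ m₁ = 1 ∧ m₂ = 2) := by
    have a : m₀ ≤ 3 := by omega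
    have b : m₁ ≤ 3 := by omega
    obtain rfl : m₂ = 3 - m₀ - m₁ := by omega
    clear h0 h1 h2 hT hf h hn k
    interval_cases m₀ <;> interval_cases m₁ <;> first | decide | omega
  rcases cases with ⟨rfl, rfl, rfl⟩ | ⟨rfl, rfl, rfl⟩ | ⟨rfl, rfl, rfl⟩ | ⟨rfl, rfl, rfl⟩ |
    ⟨rfl, rfl, rfl⟩ | ⟨rfl, rfl, rfl⟩ | ⟨rfl, rfl, rfl⟩ | ⟨rfl, rfl, rfl⟩ | ⟨rfl, rfl, rfl⟩ |
    ⟨rfl, rfl, rfl⟩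
  · obtain ⟨rfl, hms⟩ := orbitalData_one_one_one hn h0 h1 h2 hf hT
    have := congrArg (Multiset.map fun x : ℤ => 30 * 1 + 2 * x) hms
    refine Or.inr (Or.inr ⟨rfl, ?_⟩)
    simpa using this
  · exact (not_orbitalData_three_zero_zero hn h0 h1 h2 hf hT).elim
  · exact (not_orbitalData_three_zero_zero hn h1 h0 h2 (by linarith) (by linarith)).elim
  · exact (not_orbitalData_three_zero_zero hn h2 h0 h1 (by linarith) (by linarith)).elim
  · obtain ⟨rfl, rfl, rfl, rfl⟩ | ⟨rfl, rfl, rfl, rfl⟩ :=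
      orbitalData_two_one_zero hn h0 h1 h2 hf hT <;> decide
  · obtain ⟨rfl, rfl, rfl, rfl⟩ | ⟨rfl, rfl, rfl, rfl⟩ :=
      orbitalData_two_one_zero hn h0 h2 h1 (by linarith) (by linarith) <;> decide
  · obtain ⟨rfl, rfl, rfl, rfl⟩ | ⟨rfl, rfl, rfl, rfl⟩ :=
      orbitalData_two_one_zero hn h1 h0 h2 (by linarith) (by linarith) <;> decide
  · obtain ⟨rfl, rfl, rfl, rfl⟩ | ⟨rfl, rfl, rfl, rfl⟩ :=
      orbitalData_two_one_zero hn h1 h2 h0 (by linarith) (by linarith) <;> decide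
  · obtain ⟨rfl, rfl, rfl, rfl⟩ | ⟨rfl, rfl, rfl, rfl⟩ :=
      orbitalData_two_one_zero hn h2 h0 h1 (by linarith) (by linarith) <;> decide
  · obtain ⟨rfl, rfl, rfl, rfl⟩ | ⟨rfl, rfl, rfl, rfl⟩ :=
      orbitalData_two_one_zero hn h2 h1 h0 (by linarith) (by linarith) <;> decide

/-- The arithmetic of a rank four action of degree `3 p`: `d i` and `e i` count the points of the
`i`-th suborbit in the block of the base point and in another block. -/
theorem subdegrees_of_eqs {p : ℕ} (hp : 5 ≤ p) {d e : Fin 3 → ℕ} {s q T : Fin 3 → ℤ}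
    (hk : ∀ i, 0 < d i + 2 * e i)
    (hs : ∀ i, ((d i : ℤ) + 2 * e i) + (p + 1) * (d i - e i) + (p - 1) * s i = 0)
    (hq : ∀ i, ((d i : ℤ) + 2 * e i) ^ 2 + (p + 1) * (d i - e i) ^ 2 + (p - 1) * q i =
      3 * p * (d i + 2 * e i))
    (hT : ∀ i, T i = 2 * q i - s i ^ 2) (hT0 : ∀ i, 0 ≤ T i)
    (htri : T 0 ^ 2 + T 1 ^ 2 + T 2 ^ 2 = 2 * (T 0 * T 1 + T 1 * T 2 + T 2 * T 0))
    (hd : ∑ i, d i = p - 1) (he : ∑ i, e i = p) :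
    (p = 7 ∧ (Finset.univ.val.map fun i => d i + 2 * e i) = {4, 8, 8}) ∨
    (p = 19 ∧ (Finset.univ.val.map fun i => d i + 2 * e i) = {6, 20, 30}) ∨
    (p = 31 ∧ (Finset.univ.val.map fun i => d i + 2 * e i) = {20, 32, 40}) := by
  have hn : 4 ≤ (p : ℤ) - 1 := by omega
  have ex := fun i => orbitalData_of_eqs (n := (p : ℤ) - 1) (d := d i) (e := e i) (s := s i)
    (q := q i) (T := T i) hn (by positivity) (by exact_mod_cast hk i)
    (by linarith [hs i]) (by linarith [hq i]) (hT i) (hT0 i)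
  choose m f G hG hm hf using ex
  have hd' : ∑ i, (d i : ℤ) = p - 1 := by
    have : ((∑ i, d i : ℕ) : ℤ) = p - 1 := by rw [hd]; omega
    simpa using this
  have he' : ∑ i, (e i : ℤ) = p := by exact_mod_cast congrArg (Nat.cast (R := ℤ)) he
  rw [Fin.sum_univ_three] at hd' he'
  have hm3 : ∑ i, m i = 3 := by
    rw [Fin.sum_univ_three]
    apply mul_left_cancel₀ (show (p : ℤ) - 1 ≠ 0 by omega)
    linarith [hm 0, hm 1, hm 2]
  have hf1 : ∑ i, f i = 1 := by
    rw [Fin.sum_univ_three]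
    linarith [hf 0, hf 1, hf 2]
  have hk' : ∀ i, ((p : ℤ) - 1) * m i + 2 * f i = ((d i + 2 * e i : ℕ) : ℤ) := by
    intro i
    push_cast
    linarith [hm i, hf i]
  have key := OrbitalData.subdegrees_eq hn hG hm3 hf1 htri
  simp only [hk'] at key
  have huniv : (Finset.univ.val.map fun i => d i + 2 * e i) =
      {d 0 + 2 * e 0, d 1 + 2 * e 1, d 2 + 2 * e 2} := rfl
  rw [huniv]
  have inj := Multiset.map_injective (Nat.cast_injective (R := ℤ))
  rcases key with ⟨h, hms⟩ | ⟨h, hms⟩ | ⟨h, hms⟩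
  · exact Or.inl ⟨by omega, inj (by simpa using hms)⟩
  · exact Or.inr (Or.inl ⟨by omega, inj (by simpa using hms)⟩)
  · exact Or.inr (Or.inr ⟨by omega, inj (by simpa using hms)⟩)

/-! ### Multiplicity free representations -/

namespace Representation

theorem IntertwiningMap.exists_leftInverse {k G V W : Type*} [Field k] [Group G] [Finite G]
    [NeZero (Nat.card G : k)] [AddCommGroup V] [Module k V] [AddCommGroup W] [Module k W]
    {ρ : Representation k G V} {σ : Representation k G W} (f : IntertwiningMap ρ σ)
    (hf : Function.Injective f) : ∃ g : IntertwiningMap σ ρ, ∀ v, g (f v) = v := by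
  obtain ⟨g, hg⟩ := MonoidAlgebra.exists_leftInverse_of_injective
    (IntertwiningMap.equivLinearMapAsModule ρ σ f) (LinearMap.ker_eq_bot.mpr hf)
  exact ⟨(IntertwiningMap.equivLinearMapAsModule σ ρ).symm g, fun v => LinearMap.congr_fun hg v⟩

theorem isIrreducible_of_finrank_eq_one {k G V : Type*} [Field k] [Monoid G] [AddCommGroup V]
    [Module k V] (ρ : Representation k G V) (h : Module.finrank k V = 1) : ρ.IsIrreducible := by
  have hs : IsSimpleModule k V := isSimpleModule_iff_finrank_eq_one.mpr h
  have : Nontrivial V := IsSimpleModule.nontrivial k V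
  have hbot : ((⊥ : Subrepresentation ρ)).toSubmodule = ⊥ := rfl
  have htop : ((⊤ : Subrepresentation ρ)).toSubmodule = ⊤ := rfl
  refine { exists_pair_ne := ⟨⊥, ⊤, fun hc => ?_⟩, eq_bot_or_eq_top := fun W => ?_ }
  · exact bot_ne_top (α := Submodule k V) (by rw [← hbot, hc, htop])
  · rcases eq_bot_or_eq_top W.toSubmodule with hW | hW
    · exact Or.inl (Subrepresentation.toSubmodule_injective (hW.trans hbot.symm))
    · exact Or.inr (Subrepresentation.toSubmodule_injective (hW.trans htop.symm))

section Multiplicity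

variable {G V ι : Type*} [Group G] [Finite G] [AddCommGroup V] [Module ℂ V] [FiniteDimensional ℂ V]
  [Fintype ι] [DecidableEq ι] {ρ : Representation ℂ G V} {d : ι → ℕ}
  {σ : ∀ r, Representation ℂ G (Fin (d r) → ℂ)}

/-- The dimension is the inner product of the two characters, which orthonormality evaluates. -/
theorem finrank_intertwiningMap_eq_one (hσ : ∀ r, (σ r).IsIrreducible)
    (hne : ∀ r s, r ≠ s → IsEmpty (Equiv (σ r) (σ s)))
    (hχ : ∀ g, ρ.character g = ∑ r, (σ r).character g) (r : ι) :
    Module.finrank ℂ (IntertwiningMap (σ r) ρ) = 1 := by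
  classical
  have := Fintype.ofFinite G
  have hG : (Nat.card G : ℂ) ≠ 0 := Nat.cast_ne_zero.mpr Nat.card_pos.ne'
  have := invertibleOfNonzero hG
  have key := card_inv_mul_sum_char_mul_char_eq_finrank (σ r) ρ
  simp_rw [hχ, Finset.sum_mul] at key
  rw [Finset.sum_comm, Finset.mul_sum] at key
  have h : ∀ s, (Nat.card G : ℂ)⁻¹ * ∑ g : G, (σ s).character g * (σ r).character g⁻¹ =
      if s = r then 1 else 0 := by
    intro s
    have := hσ s
    have := hσ r
    rw [char_orthonormal]
    by_cases hsr : s = r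
    · subst hsr
      simp [show Nonempty (Equiv (σ s) (σ s)) from ⟨Equiv.refl _⟩]
    · have := hne r s (Ne.symm hsr)
      simp [hsr, this]
  simp_rw [h] at key
  simp only [Finset.sum_ite_eq', Finset.mem_univ, if_true] at key
  exact_mod_cast key.symm

/-- A basis of a multiplicity free representation, adapted to its irreducible constituents, on
which every endomorphism is diagonal. -/
theorem exists_basis_of_character_eq_sum (hσ : ∀ r, (σ r).IsIrreducible)
    (hne : ∀ r s, r ≠ s → IsEmpty (Equiv (σ r) (σ s)))
    (hχ : ∀ g, ρ.character g = ∑ r, (σ r).character g) :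
    ∃ b : Module.Basis (Σ r, Fin (d r)) ℂ V, ∀ M : V →ₗ[ℂ] V,
      (∀ g, M ∘ₗ ρ g = ρ g ∘ₗ M) ↔ ∃ l : ι → ℂ, ∀ x, M (b x) = l x.1 • b x := by
  have hex : ∀ r, ∃ φ : IntertwiningMap (σ r) ρ, φ ≠ 0 := by
    intro r
    have h1 := finrank_intertwiningMap_eq_one hσ hne hχ r
    have : Nontrivial (IntertwiningMap (σ r) ρ) :=
      Module.nontrivial_of_finrank_pos (R := ℂ) (by rw [h1]; exact one_pos)
    exact exists_ne 0
  choose φ hφ using hex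
  have hinj : ∀ r, Function.Injective (φ r) := fun r =>
    have := hσ r
    (IsIrreducible.injective_or_eq_zero (φ r)).resolve_right (hφ r)
  have : NeZero (Nat.card G : ℂ) := ⟨Nat.cast_ne_zero.mpr Nat.card_pos.ne'⟩
  choose ψ hψ using fun r => (φ r).exists_leftInverse (hinj r)
  have hzero : ∀ r s, r ≠ s → ∀ f : IntertwiningMap (σ r) (σ s), f = 0 := by
    intro r s hrs f
    have := hσ r
    have := hσ s
    have := hne r s hrs
    exact Subsingleton.elim f 0
  have hψφ : ∀ r s, r ≠ s → ∀ v, ψ r (φ s v) = 0 := by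
    intro r s hrs v
    have := hzero s r (Ne.symm hrs) ((ψ r).comp (φ s))
    exact congrArg (fun f : IntertwiningMap (σ s) (σ r) => f v) this
  let v : (Σ r, Fin (d r)) → V := fun x => φ x.1 (Pi.single x.2 1)
  have hli : LinearIndependent ℂ v := by
    rw [Fintype.linearIndependent_iff]
    intro c hc x
    have h1 : ψ x.1 (∑ y, c y • v y) = 0 := by rw [hc, map_zero]
    rw [Fintype.sum_sigma, map_sum] at h1
    rw [Finset.sum_eq_single x.1] at h1
    · simp_rw [map_sum, map_smul, v, hψ] at h1
      have h2 := congrFun h1 x.2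
      simpa [Finset.sum_apply, Pi.single_apply] using h2
    · intro s _ hs
      simp_rw [map_sum, map_smul, v, hψφ x.1 s (Ne.symm hs), smul_zero, Finset.sum_const_zero]
    · simp
  have hcard : Fintype.card (Σ r, Fin (d r)) = Module.finrank ℂ V := by
    have h1 := hχ 1
    simp only [char_one, Module.finrank_fin_fun] at h1
    rw [Fintype.card_sigma]
    simp only [Fintype.card_fin]
    exact_mod_cast h1.symm
  have hspan : ⊤ ≤ Submodule.span ℂ (Set.range v) :=
    (hli.span_eq_top_of_card_eq_finrank' hcard).ge
  refine ⟨Module.Basis.mk hli hspan, fun M => ⟨fun hM => ?_, ?_⟩⟩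
  · have hsum : ∀ w, w = ∑ r, φ r (ψ r w) := by
      have : LinearMap.id = ∑ r, (φ r).toLinearMap ∘ₗ (ψ r).toLinearMap := by
        refine (Module.Basis.mk hli hspan).ext fun x => ?_
        rw [Module.Basis.mk_apply, LinearMap.sum_apply, Finset.sum_eq_single x.1]
        · simp [v, hψ]
        · intro s _ hs
          simp [v, hψφ s x.1 hs]
        · simp
      intro w
      have := LinearMap.congr_fun this w
      simpa using this
    let Mi : IntertwiningMap ρ ρ := ⟨M, hM⟩
    have hscal : ∀ r, ∃ c : ℂ, ∀ u, ψ r (M (φ r u)) = c • u := by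
      intro r
      have := hσ r
      obtain ⟨c, hc⟩ := (IsIrreducible.algebraMap_intertwiningMap_bijective_of_isAlgClosed
        (ρ := σ r)).2 ((ψ r).comp (Mi.comp (φ r)))
      refine ⟨c, fun u => ?_⟩
      have := congrArg (fun f : IntertwiningMap (σ r) (σ r) => f u) hc
      simp only [Algebra.algebraMap_eq_smul_one] at this
      exact this.symm
    choose l hl using hscal
    refine ⟨l, fun x => ?_⟩
    rw [Module.Basis.mk_apply, hsum (M (v x)), Finset.sum_eq_single x.1]
    · simp [v, hl]
    · intro s _ hs
      have := hzero x.1 s (Ne.symm hs) ((ψ s).comp (Mi.comp (φ x.1)))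
      have h2 : ψ s (M (v x)) = 0 :=
        congrArg (fun f : IntertwiningMap (σ x.1) (σ s) => f (Pi.single x.2 1)) this
      rw [h2, map_zero]
    · simp
  · rintro ⟨l, hl⟩ g
    have hφl : ∀ r u, M (φ r u) = l r • φ r u := by
      intro r u
      have : M ∘ₗ (φ r).toLinearMap = l r • (φ r).toLinearMap := by
        refine (Pi.basisFun ℂ (Fin (d r))).ext fun i => ?_
        have := hl ⟨r, i⟩
        rw [Module.Basis.mk_apply] at this
        simpa [v] using this
      simpa using LinearMap.congr_fun this u
    refine (Module.Basis.mk hli hspan).ext fun x => ?_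
    have h1 : ρ g (v x) = φ x.1 (σ x.1 g (Pi.single x.2 1)) :=
      (IntertwiningMap.isIntertwining _ _ (φ x.1) g _).symm
    simp only [Module.Basis.mk_apply, LinearMap.comp_apply]
    rw [h1, hφl]
    have : M (v x) = l x.1 • v x := hφl _ _
    rw [this, map_smul, h1]

end Multiplicity

end Representation

/-! ### Diagonalization of the algebra of invariant matrices -/

section

open Polynomial in
/-- `D` identifies `ι → ℂ` with the algebra of `G`-invariant matrices in such a way that the `r`-th
coordinate is an eigenvalue of multiplicity `d r`. -/
structure IsOrbitalDiagonalization (G : Type*) {Ω ι : Type*} [Group G] [MulAction G Ω] [Fintype Ω]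
    [DecidableEq Ω] [Fintype ι] (d : ι → ℕ) (D : (ι → ℂ) →ₐ[ℂ] Matrix Ω Ω ℂ) : Prop where
  invariant_iff : ∀ M : Matrix Ω Ω ℂ,
    (∀ (g : G) x y, M (g • x) (g • y) = M x y) ↔ ∃ l, D l = M
  charpoly_eq : ∀ l, (D l).charpoly = ∏ r, (X - C (l r)) ^ d r
  trace_eq : ∀ l, (D l).trace = ∑ r, d r * l r

theorem Representation.exists_isOrbitalDiagonalization {G Ω ι : Type*} [Group G] [Finite G] [MulAction G Ω]
    [Fintype Ω] [DecidableEq Ω] [Fintype ι] [DecidableEq ι] {d : ι → ℕ}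
    {σ : ∀ r, Representation ℂ G (Fin (d r) → ℂ)} (hσ : ∀ r, (σ r).IsIrreducible)
    (hne : ∀ r s, r ≠ s → IsEmpty (Representation.Equiv (σ r) (σ s)))
    (hχ : ∀ g, permutationCharacter G Ω g = ∑ r, (σ r).character g) :
    ∃ D, IsOrbitalDiagonalization G (Ω := Ω) d D := by
  let e : Module.Basis Ω ℂ (MonoidAlgebra ℂ Ω) := .ofRepr (MonoidAlgebra.coeffLinearEquiv ℂ)
  have : FiniteDimensional ℂ (MonoidAlgebra ℂ Ω) := Module.Finite.of_basis e
  obtain ⟨b, hb⟩ := Representation.exists_basis_of_character_eq_sum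
    (ρ := Representation.ofMulAction ℂ G Ω) hσ hne hχ
  have hge : ∀ (g : G) x, Representation.ofMulAction ℂ G Ω g (e x) = e (g • x) := by
    intro g x
    have : ∀ y, e y = MonoidAlgebra.single y 1 := fun y => rfl
    rw [this, this, Representation.ofMulAction_single]
  let diag : (ι → ℂ) →ₐ[ℂ] Matrix (Σ r, Fin (d r)) (Σ r, Fin (d r)) ℂ :=
    (Matrix.diagonalAlgHom ℂ).comp (AlgHom.pi fun x => Pi.evalAlgHom ℂ (fun _ => ℂ) x.1)
  have hdiag : ∀ l, diag l = Matrix.diagonal fun x => l x.1 := fun l => rfl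
  let D : (ι → ℂ) →ₐ[ℂ] Matrix Ω Ω ℂ :=
    ((LinearMap.toMatrixAlgEquiv e).toAlgHom.comp (Matrix.toLinAlgEquiv b).toAlgHom).comp diag
  have hD : ∀ l, D l = LinearMap.toMatrix e e (Matrix.toLin b b (diag l)) := fun l => rfl
  refine ⟨D, ⟨fun M => ?_, fun l => ?_, fun l => ?_⟩⟩
  · have h1 : (∀ (g : G) x y, M (g • x) (g • y) = M x y) ↔
        ∀ g, Matrix.toLin e e M ∘ₗ Representation.ofMulAction ℂ G Ω g =
          Representation.ofMulAction ℂ G Ω g ∘ₗ Matrix.toLin e e M := by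
      refine forall_congr' fun g => ⟨fun h => e.ext fun y => ?_, fun h x y => ?_⟩
      · simp only [LinearMap.comp_apply, hge, Matrix.toLin_self, map_sum, map_smul]
        rw [← Equiv.sum_comp (MulAction.toPerm g)]
        simp [h]
      · have := congrArg (fun v => e.repr v (g • x)) (LinearMap.congr_fun h (e y))
        simp only [LinearMap.comp_apply, hge, Matrix.toLin_self, map_sum, map_smul,
          Module.Basis.repr_self, Finsupp.finsetSum_apply, Finsupp.smul_apply,
          Finsupp.single_apply] at this
        simpa using this
    rw [h1, hb]
    refine exists_congr fun l => ?_
    have hbx : ∀ x, Matrix.toLin b b (diag l) (b x) = l x.1 • b x := by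
      intro x
      rw [Matrix.toLin_self, Finset.sum_eq_single x]
      · rw [hdiag, Matrix.diagonal_apply_eq]
      · intro y _ hy
        rw [hdiag, Matrix.diagonal_apply_ne _ hy, zero_smul]
      · simp
    rw [hD]
    constructor
    · intro h
      have : Matrix.toLin b b (diag l) = Matrix.toLin e e M :=
        b.ext fun x => by rw [hbx, h]
      rw [this, LinearMap.toMatrix_toLin]
    · rintro rfl x
      rw [Matrix.toLin_toMatrix, hbx]
  · rw [hD, LinearMap.charpoly_toMatrix, Matrix.charpoly_toLin, hdiag, Matrix.charpoly_diagonal,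
      Fintype.prod_sigma]
    simp
  · rw [hD, ← LinearMap.trace_eq_matrix_trace ℂ e, LinearMap.trace_eq_matrix_trace ℂ b,
      LinearMap.toMatrix_toLin, hdiag, Matrix.trace_diagonal, Fintype.sum_sigma]
    simp

theorem IsTypeVII.exists_isOrbitalDiagonalization {p : ℕ} {G Ω : Type*} [Group G] [Finite G] [MulAction G Ω]
    [Fintype Ω] [DecidableEq Ω] (hp : 5 ≤ p) (h : IsTypeVII p G Ω) :
    ∃ D, IsOrbitalDiagonalization G (Ω := Ω) ![1, p + 1, p - 1, p - 1] D := by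
  obtain ⟨χ₁, χ₂, χ₃, ⟨ρ₁, h₁, rfl⟩, ⟨ρ₂, h₂, rfl⟩, ⟨ρ₃, h₃, rfl⟩, hne, hχ⟩ := h
  let σ : ∀ r : Fin 4, Representation ℂ G (Fin (![1, p + 1, p - 1, p - 1] r) → ℂ) := fun
    | 0 => Representation.trivial ℂ G (Fin 1 → ℂ)
    | 1 => ρ₁
    | 2 => ρ₂
    | 3 => ρ₃
  have hdim : ∀ r s, Nonempty (Representation.Equiv (σ r) (σ s)) →
      ![1, p + 1, p - 1, p - 1] r = ![1, p + 1, p - 1, p - 1] s := by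
    rintro r s ⟨f⟩
    have := f.toLinearEquiv.finrank_eq
    rwa [Module.finrank_fin_fun, Module.finrank_fin_fun] at this
  have hchar : ∀ r s, Nonempty (Representation.Equiv (σ r) (σ s)) →
      (σ r).character = (σ s).character := by
    rintro r s ⟨f⟩
    exact Representation.char_iso f
  refine Representation.exists_isOrbitalDiagonalization (σ := σ) ?_ ?_ ?_
  · intro r
    fin_cases r
    · exact Representation.isIrreducible_of_finrank_eq_one _ (Module.finrank_fin_fun ℂ)
    · exact h₁
    · exact h₂
    · exact h₃
  · intro r s hrs
    rw [← not_nonempty_iff]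
    intro hiso
    have e1 := hdim r s hiso
    have e2 := hchar r s hiso
    -- Degrees separate all constituents except the two of degree `p - 1`, which `χ₂ ≠ χ₃`
    -- separates.
    fin_cases r <;> fin_cases s <;>
      first
      | exact hrs rfl
      | exact hne e2
      | exact hne e2.symm
      | (simp at e1 <;> omega)
  · intro g
    rw [hχ, Fin.sum_univ_four]
    have : (σ 0).character g = 1 := by
      change LinearMap.trace ℂ (Fin 1 → ℂ) 1 = 1
      rw [LinearMap.trace_one, Module.finrank_fin_fun, Nat.cast_one]
    rw [this]
    rfl

end

/-! ### Orbital colourings, idempotents and adjoints -/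

section

open Matrix ComplexConjugate

/-- `c` is a colouring of `Ω × Ω` whose colour classes are the orbitals of `G`. -/
structure IsOrbitalColoring (G : Type*) {Ω Q : Type*} [Group G] [MulAction G Ω] (c : Ω → Ω → Q) :
    Prop where
  eq_iff : ∀ x y x' y', c x y = c x' y' ↔ ∃ g : G, g • x = x' ∧ g • y = y'
  exists_eq : ∀ q x, ∃ y, c x y = q

/-- The adjacency matrix of a colour class. -/
def colorMatrix (R : Type*) [Zero R] [One R] {Ω Q : Type*} [DecidableEq Q] (c : Ω → Ω → Q)
    (q : Q) : Matrix Ω Ω R :=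
  Matrix.of fun x y => if c x y = q then 1 else 0

namespace IsOrbitalColoring

variable {G Ω Q : Type*} [Group G] [MulAction G Ω] {c : Ω → Ω → Q}

theorem smul (hc : IsOrbitalColoring G c) (g : G) (x y : Ω) : c (g • x) (g • y) = c x y :=
  ((hc.eq_iff _ _ _ _).mpr ⟨g, rfl, rfl⟩).symm

theorem invariant_iff {R : Type*} (hc : IsOrbitalColoring G c) [Nonempty Ω] (M : Matrix Ω Ω R) :
    (∀ (g : G) x y, M (g • x) (g • y) = M x y) ↔ ∃ m : Q → R, ∀ x y, M x y = m (c x y) := by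
  constructor
  · intro h
    obtain ⟨x₀⟩ := ‹Nonempty Ω›
    choose y hy using fun q => hc.exists_eq q x₀
    refine ⟨fun q => M x₀ (y q), fun x z => ?_⟩
    obtain ⟨g, hg1, hg2⟩ := (hc.eq_iff _ _ _ _).mp (hy (c x z))
    rw [← hg1, ← hg2, h]
    rw [hg1, hg2]
  · rintro ⟨m, hm⟩ g x y
    rw [hm, hm, hc.smul]

theorem card_eq [Fintype Ω] [DecidableEq Q] [MulAction.IsPretransitive G Ω]
    (hc : IsOrbitalColoring G c) (q : Q) (x x' : Ω) :
    Fintype.card {y // c x y = q} = Fintype.card {y // c x' y = q} := by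
  obtain ⟨g, rfl⟩ := MulAction.exists_smul_eq G x x'
  refine Fintype.card_congr ((MulAction.toPerm g).subtypeEquiv fun y => ?_)
  rw [MulAction.toPerm_apply, hc.smul]

theorem eq_self_iff (hc : IsOrbitalColoring G c) (x y : Ω) : c x y = c x x ↔ y = x := by
  constructor
  · intro h
    obtain ⟨g, h1, h2⟩ := (hc.eq_iff _ _ _ _).mp h
    exact MulAction.injective g (h2.trans h1.symm)
  · rintro rfl; rfl

theorem self_eq_self [MulAction.IsPretransitive G Ω] (hc : IsOrbitalColoring G c) (x y : Ω) :
    c x x = c y y := by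
  obtain ⟨g, rfl⟩ := MulAction.exists_smul_eq G x y
  rw [hc.smul]

theorem smul_colorMatrix {R : Type*} [Zero R] [One R] [DecidableEq Q] (hc : IsOrbitalColoring G c)
    (q : Q) (g : G) (x y : Ω) :
    colorMatrix R c q (g • x) (g • y) = colorMatrix R c q x y := by
  simp [colorMatrix, hc.smul]

end IsOrbitalColoring

namespace IsOrbitalDiagonalization

variable {G Ω ι : Type*} [Group G] [MulAction G Ω] [Fintype Ω] [DecidableEq Ω] [Fintype ι]
  [DecidableEq ι] {d : ι → ℕ} {D : (ι → ℂ) →ₐ[ℂ] Matrix Ω Ω ℂ}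

theorem injective (h : IsOrbitalDiagonalization G d D) (hd : ∀ r, d r ≠ 0) :
    Function.Injective D := by
  rw [injective_iff_map_eq_zero]
  intro l hl
  ext r
  have h1 := h.trace_eq (l * Pi.single r 1)
  rw [map_mul, hl, zero_mul, Matrix.trace_zero, Finset.sum_eq_single r] at h1
  · simpa [hd r] using h1
  · intro s _ hs
    simp [hs]
  · simp

/-- Both sides are the dimension of the space of invariant matrices: one counts colours, the other
eigenvalue coordinates. -/
theorem card_eq {Q : Type*} [Fintype Q] [Nonempty Ω] {c : Ω → Ω → Q}
    (h : IsOrbitalDiagonalization G d D) (hd : ∀ r, d r ≠ 0) (hc : IsOrbitalColoring G c) :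
    Fintype.card Q = Fintype.card ι := by
  obtain ⟨x₀⟩ := ‹Nonempty Ω›
  choose y hy using fun q => hc.exists_eq q x₀
  let L : (ι → ℂ) →ₗ[ℂ] (Q → ℂ) :=
    { toFun := fun l q => D l x₀ (y q)
      map_add' := fun l l' => by ext; simp
      map_smul' := fun a l => by ext; simp }
  have hLc : ∀ l x z, D l x z = L l (c x z) := by
    intro l
    obtain ⟨m, hm⟩ := (hc.invariant_iff (D l)).mp ((h.invariant_iff _).mpr ⟨l, rfl⟩)
    intro x z
    change D l x z = D l x₀ (y (c x z))
    rw [hm, hm, hy]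
  have hL : Function.Bijective L := by
    constructor
    · intro l l' hll
      apply h.injective hd
      ext x z
      rw [hLc, hLc, hll]
    · intro m
      obtain ⟨l, hl⟩ := (h.invariant_iff (Matrix.of fun x z => m (c x z))).mp
        ((hc.invariant_iff _).mpr ⟨m, fun _ _ => rfl⟩)
      refine ⟨l, funext fun q => ?_⟩
      change D l x₀ (y q) = m q
      rw [hl, Matrix.of_apply, hy]
  have := (LinearEquiv.ofBijective L hL).finrank_eq
  simpa using this.symm

-- The adjoint of the idempotent `D (Pi.single r 1)` is again an invariant idempotent, so its
-- coordinates are `0` or `1`. Its `r`-th coordinate is `1`, as otherwise `Mᴴ * M = 0`; equality of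
-- traces then leaves no room for another one.
open scoped ComplexOrder in
theorem conjTranspose_single (h : IsOrbitalDiagonalization G d D) (hd : ∀ r, d r ≠ 0) (r : ι) :
    (D (Pi.single r 1))ᴴ = D (Pi.single r 1) := by
  have hinj := h.injective hd
  obtain ⟨μ, hμ⟩ := (h.invariant_iff (D (Pi.single r 1))ᴴ).mp fun g x y => by
    rw [conjTranspose_apply, conjTranspose_apply, (h.invariant_iff _).mpr ⟨_, rfl⟩]
  have hidem : μ * μ = μ := by
    apply hinj
    rw [map_mul, hμ, ← conjTranspose_mul, ← map_mul, ← Pi.single_mul, one_mul]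
  have h01 : ∀ s, μ s = 0 ∨ μ s = 1 := by
    intro s
    have := congrFun hidem s
    rw [Pi.mul_apply] at this
    exact IsIdempotentElem.iff_eq_zero_or_one.mp this
  have hr : μ r = 1 := by
    refine (h01 r).resolve_left fun h0 => ?_
    have h1 : (D (Pi.single r 1))ᴴ * D (Pi.single r 1) = 0 := by
      rw [← hμ, ← map_mul, ← map_zero D]
      congr 1
      ext s
      by_cases hs : s = r
      · subst hs; simp [h0]
      · simp [hs]
    rw [conjTranspose_mul_self_eq_zero] at h1
    have h2 := hinj (h1.trans (map_zero D).symm)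
    have := congrFun h2 r
    simp at this
  rw [← hμ]
  congr 1
  have htr := h.trace_eq μ
  rw [hμ, trace_conjTranspose, h.trace_eq] at htr
  choose ε hε using fun s => show ∃ n : ℕ, μ s = n from
    (h01 s).elim (fun h => ⟨0, by simpa using h⟩) (fun h => ⟨1, by simpa using h⟩)
  have h3 : ∑ s, d s * ε s = d r := by
    have h4 : star (∑ s, (d s : ℂ) * (Pi.single r 1 : ι → ℂ) s) = d r := by
      rw [Finset.sum_eq_single r]
      · simp
      · intro s _ hs
        simp [hs]
      · simp
    rw [h4] at htr
    simp_rw [hε] at htr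
    exact_mod_cast htr.symm
  have hεr : ε r = 1 := by
    have := hε r
    rw [hr] at this
    exact_mod_cast this.symm
  rw [← Finset.add_sum_erase _ _ (Finset.mem_univ r), hεr, mul_one] at h3
  have h5 : ∑ s ∈ Finset.univ.erase r, d s * ε s = 0 := by omega
  ext s
  by_cases hs : s = r
  · subst hs; simp [hr]
  · have := Finset.sum_eq_zero_iff.mp h5 s (by simp [hs])
    have : ε s = 0 := (mul_eq_zero.mp this).resolve_left (hd s)
    rw [hε, this, Pi.single_eq_of_ne hs, Nat.cast_zero]

theorem conjTranspose_eq (h : IsOrbitalDiagonalization G d D) (hd : ∀ r, d r ≠ 0) (l : ι → ℂ) :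
    (D l)ᴴ = D (star l) := by
  have hl : ∀ l : ι → ℂ, D l = ∑ r, l r • D (Pi.single r 1) := by
    intro l
    conv_lhs => rw [← Finset.univ_sum_single l]
    rw [map_sum]
    refine Finset.sum_congr rfl fun r _ => ?_
    rw [← map_smul, ← Pi.single_smul, smul_eq_mul, mul_one]
  rw [hl, hl, conjTranspose_sum]
  refine Finset.sum_congr rfl fun r _ => ?_
  rw [conjTranspose_smul, h.conjTranspose_single hd, Pi.star_apply]

/-- The all-ones matrix is a multiple of the projection belonging to the unique multiplicity
one eigenvalue. -/
theorem single_eq_allOnes [Nonempty Ω] (h : IsOrbitalDiagonalization G d D) (hd : ∀ r, d r ≠ 0)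
    {r₀ : ι} (h₀ : d r₀ = 1) (h₁ : ∀ r, r ≠ r₀ → 1 < d r) :
    D (Pi.single r₀ (Fintype.card Ω)) = Matrix.of fun _ _ => 1 := by
  have hN : (Fintype.card Ω : ℂ) ≠ 0 := Nat.cast_ne_zero.mpr Fintype.card_ne_zero
  obtain ⟨μ, hμ⟩ := (h.invariant_iff (Matrix.of fun _ _ => 1)).mp fun _ _ _ => rfl
  -- The all-ones matrix `J` satisfies `J² = |Ω| J` and has trace `|Ω|`, so it is `|Ω|` times an
  -- idempotent of trace `1`.
  have hsq : μ * μ = (Fintype.card Ω : ℂ) • μ := by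
    apply h.injective hd
    rw [map_mul, map_smul, hμ]
    ext x y
    simp [Matrix.mul_apply]
  have h01 : ∀ s, ∃ ε : ℕ, μ s = Fintype.card Ω * ε := by
    intro s
    have := congrFun hsq s
    simp only [Pi.mul_apply, Pi.smul_apply, smul_eq_mul] at this
    rcases eq_or_ne (μ s) 0 with h0 | h0
    · exact ⟨0, by simp [h0]⟩
    · exact ⟨1, by simpa using mul_right_cancel₀ h0 this⟩
  choose ε hε using h01
  have htr := h.trace_eq μ
  rw [hμ] at htr
  have h3 : ∑ s, d s * ε s = 1 := by
    have h4 : (Fintype.card Ω : ℂ) * ∑ s, (d s : ℂ) * ε s = Fintype.card Ω := by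
      rw [Finset.mul_sum]
      trans (Matrix.of fun _ _ => 1 : Matrix Ω Ω ℂ).trace
      · rw [htr]
        refine Finset.sum_congr rfl fun s _ => ?_
        rw [hε]; ring
      · simp [Matrix.trace]
    have := mul_left_cancel₀ hN (h4.trans (mul_one _).symm)
    exact_mod_cast this
  have hz : ∀ s, s ≠ r₀ → ε s = 0 := by
    intro s hs
    have h5 := Finset.single_le_sum (f := fun s => d s * ε s) (fun _ _ => Nat.zero_le _)
      (Finset.mem_univ s)
    rw [h3] at h5
    by_contra hne
    have := h₁ s hs
    have : 1 ≤ ε s := Nat.one_le_iff_ne_zero.mpr hne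
    nlinarith
  rw [← hμ]
  congr 1
  rw [Finset.sum_eq_single r₀ (fun s _ hs => by rw [hz s hs, mul_zero]) (by simp), h₀,
    one_mul] at h3
  ext s
  by_cases hs : s = r₀
  · subst hs; simp [hε, h3]
  · simp [hs, hε, hz s hs]

end IsOrbitalDiagonalization

end

/-! ### Conjugate roots and their multiplicities -/

section

open Matrix ComplexConjugate Polynomial

/-- Write `g = μ ^ m * r` with `μ ∤ r`. In characteristic zero `μ` is separable, and `r` has no root
in common with it, so every root of `μ` has multiplicity exactly `m` in `g`. -/
theorem Polynomial.rootMultiplicity_eq_of_irreducible {F K : Type*} [Field F] [CharZero F]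
    [Field K] [Algebra F K] {g μ : F[X]} (hg : g ≠ 0) (hμ : Irreducible μ) {a a' : K}
    (ha : aeval a μ = 0) (ha' : aeval a' μ = 0) :
    (g.map (algebraMap F K)).rootMultiplicity a = (g.map (algebraMap F K)).rootMultiplicity a' := by
  obtain ⟨r, hgr, hr⟩ :=
    (FiniteMultiplicity.of_not_isUnit hμ.not_isUnit hg).exists_eq_pow_mul_and_not_dvd
  generalize multiplicity μ g = m at hgr
  have hμ0 : μ.map (algebraMap F K) ≠ 0 := Polynomial.map_ne_zero hμ.ne_zero
  have key : ∀ b : K, aeval b μ = 0 →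
      (g.map (algebraMap F K)).rootMultiplicity b = m := by
    intro b hb
    have h1 : (r.map (algebraMap F K)).rootMultiplicity b = 0 := by
      apply rootMultiplicity_eq_zero
      intro hroot
      rw [IsRoot, eval_map_algebraMap] at hroot
      have e := minpoly.eq_of_irreducible hμ hb
      have h2 := minpoly.dvd F b hroot
      rw [← e] at h2
      exact hr ((Dvd.intro _ rfl).trans h2)
    have h2 : (μ.map (algebraMap F K)).rootMultiplicity b = 1 := by
      apply le_antisymm
      · exact rootMultiplicity_le_one_of_separable (hμ.separable.map) b
      · rw [Nat.one_le_iff_ne_zero, ← Nat.pos_iff_ne_zero, rootMultiplicity_pos hμ0, IsRoot,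
          eval_map_algebraMap, hb]
    have h0 : (g.map (algebraMap F K)) ≠ 0 := Polynomial.map_ne_zero hg
    rw [hgr, Polynomial.map_mul, Polynomial.map_pow] at h0 ⊢
    have hpow : ∀ n : ℕ, ((μ.map (algebraMap F K)) ^ n).rootMultiplicity b = n := by
      intro n
      induction n with
      | zero => simp
      | succ n ih =>
        rw [pow_succ, rootMultiplicity_mul (mul_ne_zero (pow_ne_zero _ hμ0) hμ0), ih, h2]
    rw [rootMultiplicity_mul h0, hpow, h1, add_zero]
  rw [key a ha, key a' ha']

theorem exists_int_eq_of_isIntegral {x : ℂ} (hx : IsIntegral ℤ x) (y : ℚ) (hy : x = y) :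
    ∃ z : ℤ, x = z := by
  have h1 : IsIntegral ℤ y := by
    rw [← isIntegral_algebraMap_iff (algebraMap ℚ ℂ).injective]
    rwa [eq_ratCast, ← hy]
  obtain ⟨z, hz⟩ := IsIntegrallyClosed.isIntegral_iff.mp h1
  refine ⟨z, ?_⟩
  rw [hy, ← hz]
  simp

theorem Polynomial.rootMultiplicity_X_sub_C_pow' {K : Type*} [Field K] [DecidableEq K] (a b : K)
    (n : ℕ) : ((X - C a) ^ n).rootMultiplicity b = if b = a then n else 0 := by
  split_ifs with h
  · rw [h, rootMultiplicity_X_sub_C_pow]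
  · apply rootMultiplicity_eq_zero
    simp only [IsRoot, eval_pow, eval_sub, eval_X, eval_C]
    exact pow_ne_zero _ (sub_ne_zero.mpr h)

/-- In a monic integral polynomial, a root whose multiplicity cannot be that of another root is
an integer. -/
theorem exists_int_eq_of_map_eq_prod {f : ℤ[X]} (hf : f.Monic) {p : ℕ} (hp : 5 ≤ p)
    {l : Fin 4 → ℂ} (h : f.map (algebraMap ℤ ℂ) =
      ∏ r, (X - C (l r)) ^ (![1, p + 1, p - 1, p - 1] : Fin 4 → ℕ) r) : ∃ z : ℤ, l 1 = z := by
  classical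
  have hint : IsIntegral ℤ (l 1) := by
    refine ⟨f, hf, ?_⟩
    rw [← eval_map, h, eval_prod]
    refine Finset.prod_eq_zero (Finset.mem_univ 1) ?_
    simp
  have hintQ : IsIntegral ℚ (l 1) := hint.tower_top
  have hirr := minpoly.irreducible hintQ
  by_cases hdeg : (minpoly ℚ (l 1)).natDegree = 1
  · have := minpoly.natDegree_eq_one_iff.mp hdeg
    obtain ⟨y, hy⟩ := this
    exact exists_int_eq_of_isIntegral hint y (by rw [← hy]; simp)
  exfalso
  obtain ⟨a', ha', hne⟩ : ∃ a' : ℂ, aeval a' (minpoly ℚ (l 1)) = 0 ∧ a' ≠ l 1 := by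
    by_contra! hc
    have hcard := card_rootSet_eq_natDegree (K := ℂ) hirr.separable (IsAlgClosed.splits _)
    have hle : Fintype.card ((minpoly ℚ (l 1)).rootSet ℂ) ≤ 1 := by
      rw [Fintype.card_le_one_iff]
      rintro ⟨u, hu⟩ ⟨v, hv⟩
      rw [Subtype.mk.injEq, hc u (mem_rootSet.mp hu).2, hc v (mem_rootSet.mp hv).2]
    have := minpoly.natDegree_pos hintQ
    omega
  have hmap : (f.map (algebraMap ℤ ℚ)).map (algebraMap ℚ ℂ) = f.map (algebraMap ℤ ℂ) := by
    rw [Polynomial.map_map]; rfl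
  have key := rootMultiplicity_eq_of_irreducible (K := ℂ) (g := f.map (algebraMap ℤ ℚ))
    (hf.map _).ne_zero hirr (minpoly.aeval ℚ (l 1)) ha'
  rw [hmap, h, Fin.prod_univ_four] at key
  have hX : ∀ (a : ℂ) (n : ℕ), (X - C a) ^ n ≠ 0 := fun a n => pow_ne_zero _ (X_sub_C_ne_zero a)
  have hm : ∀ b : ℂ, ((X - C (l 0)) ^ (![1, p + 1, p - 1, p - 1] : Fin 4 → ℕ) 0 *
      (X - C (l 1)) ^ (![1, p + 1, p - 1, p - 1] : Fin 4 → ℕ) 1 *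
      (X - C (l 2)) ^ (![1, p + 1, p - 1, p - 1] : Fin 4 → ℕ) 2 *
      (X - C (l 3)) ^ (![1, p + 1, p - 1, p - 1] : Fin 4 → ℕ) 3).rootMultiplicity b =
      (if b = l 0 then 1 else 0) + (if b = l 1 then p + 1 else 0) +
      (if b = l 2 then p - 1 else 0) + (if b = l 3 then p - 1 else 0) := by
    intro b
    rw [rootMultiplicity_mul (mul_ne_zero (mul_ne_zero (mul_ne_zero (hX _ _) (hX _ _)) (hX _ _))
      (hX _ _)), rootMultiplicity_mul (mul_ne_zero (mul_ne_zero (hX _ _) (hX _ _)) (hX _ _)),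
      rootMultiplicity_mul (mul_ne_zero (hX _ _) (hX _ _))]
    simp only [rootMultiplicity_X_sub_C_pow']
    rfl
  rw [hm, hm, if_pos rfl, if_neg hne] at key
  -- The conjugate `a'` can reach multiplicity `p + 1` only as `a' = l 2 = l 3`, with multiplicity
  -- `2 * p - 2` or `2 * p - 1`. Then `l 1` has multiplicity `p + 1` or `p + 2`, and equality would
  -- need `p ≤ 4`.
  split_ifs at key <;> omega

end

/-! ### Eigenvalues of the orbital matrices -/

section

open Matrix ComplexConjugate Polynomial

/-- A complex number with real square lies on the real or the imaginary axis. As the sum vanishes,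
all three lie on the same axis, and the claim is an identity for three real numbers with sum zero.
-/
theorem Complex.normSq_identity_of_sum_eq_zero {t : Fin 3 → ℂ} (hsum : ∑ i, t i = 0)
    (hreal : ∀ i, (t i ^ 2).im = 0) :
    normSq (t 0) ^ 2 + normSq (t 1) ^ 2 + normSq (t 2) ^ 2 =
      2 * (normSq (t 0) * normSq (t 1) + normSq (t 1) * normSq (t 2) +
        normSq (t 2) * normSq (t 0)) := by
  have h : ∀ i, (t i).re = 0 ∨ (t i).im = 0 := by
    intro i
    have := hreal i
    rw [sq, Complex.mul_im] at this
    have : (t i).re * (t i).im = 0 := by linarith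
    exact mul_eq_zero.mp this
  rw [Fin.sum_univ_three] at hsum
  have hre := congrArg Complex.re hsum
  have him := congrArg Complex.im hsum
  simp only [Complex.add_re, Complex.add_im, Complex.zero_re, Complex.zero_im] at hre him
  simp only [Complex.normSq_apply]
  have key : ((t 0).re = 0 ∧ (t 1).re = 0 ∧ (t 2).re = 0) ∨
      ((t 0).im = 0 ∧ (t 1).im = 0 ∧ (t 2).im = 0) := by
    rcases h 0 with h0 | h0 <;> rcases h 1 with h1 | h1 <;> rcases h 2 with h2 | h2 <;>
      simp only [h0, h1, h2] at hre him ⊢ <;> simp at hre him ⊢ <;> simp [hre, him]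
  rcases key with ⟨h0, h1, h2⟩ | ⟨h0, h1, h2⟩
  · rw [h0, h1, h2]
    obtain h3 : (t 2).im = -(t 0).im - (t 1).im := by linarith
    rw [h3]; ring
  · rw [h0, h1, h2]
    obtain h3 : (t 2).re = -(t 0).re - (t 1).re := by linarith
    rw [h3]; ring

/-- The eigenvalues `l q` of the adjacency matrices of a colouring by orbitals. -/
structure IsEigenvalueSystem {G Ω Q ι : Type*} [Group G] [MulAction G Ω] [Fintype Ω]
    [DecidableEq Ω] [Fintype ι] [DecidableEq ι] [DecidableEq Q] (d : ι → ℕ)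
    (D : (ι → ℂ) →ₐ[ℂ] Matrix Ω Ω ℂ) (c : Ω → Ω → Q) (k : Q → ℕ) (l : Q → ι → ℂ) : Prop where
  diag : IsOrbitalDiagonalization G d D
  coloring : IsOrbitalColoring G c
  card_eq : ∀ q x, Fintype.card {y // c x y = q} = k q
  map_eq : ∀ q, D (l q) = colorMatrix ℂ c q
  d_ne_zero : ∀ r, d r ≠ 0

theorem exists_isEigenvalueSystem {G Ω Q ι : Type*} [Group G] [MulAction G Ω] [Fintype Ω]
    [DecidableEq Ω] [Fintype ι] [DecidableEq ι] [DecidableEq Q] [Nonempty Ω]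
    [MulAction.IsPretransitive G Ω] {d : ι → ℕ} {D : (ι → ℂ) →ₐ[ℂ] Matrix Ω Ω ℂ}
    (h : IsOrbitalDiagonalization G d D) (hd : ∀ r, d r ≠ 0) {c : Ω → Ω → Q}
    (hc : IsOrbitalColoring G c) : ∃ k l, IsEigenvalueSystem (G := G) d D c k l := by
  obtain ⟨x₀⟩ := ‹Nonempty Ω›
  have : ∀ q, ∃ l, D l = colorMatrix ℂ c q := fun q =>
    (h.invariant_iff _).mp fun g x y => hc.smul_colorMatrix q g x y
  choose l hl using this
  exact ⟨fun q => Fintype.card {y // c x₀ y = q}, l, h, hc, fun q x => hc.card_eq q x x₀, hl, hd⟩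

namespace IsEigenvalueSystem

variable {G Ω Q ι : Type*} [Group G] [MulAction G Ω] [Fintype Ω] [DecidableEq Ω] [Fintype ι]
  [DecidableEq ι] [DecidableEq Q] {d : ι → ℕ} {D : (ι → ℂ) →ₐ[ℂ] Matrix Ω Ω ℂ} {c : Ω → Ω → Q}
  {k : Q → ℕ} {l : Q → ι → ℂ}

theorem row_sum {R : Type*} [Semiring R] (h : IsEigenvalueSystem (G := G) d D c k l) (q : Q)
    (x : Ω) : ∑ y, colorMatrix R c q x y = k q := by
  simp only [colorMatrix, Matrix.of_apply]
  rw [Finset.sum_boole, ← h.card_eq q x, Fintype.card_subtype]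

theorem apply_eq_card [Nonempty Ω] (h : IsEigenvalueSystem (G := G) d D c k l) {r₀ : ι}
    (h₀ : d r₀ = 1) (h₁ : ∀ r, r ≠ r₀ → 1 < d r) (q : Q) : l q r₀ = k q := by
  have hN : (Fintype.card Ω : ℂ) ≠ 0 := Nat.cast_ne_zero.mpr Fintype.card_ne_zero
  have hJ := h.diag.single_eq_allOnes h.d_ne_zero h₀ h₁
  have : l q * Pi.single r₀ (Fintype.card Ω : ℂ) = (k q : ℂ) • Pi.single r₀ (Fintype.card Ω : ℂ) := by
    apply h.diag.injective h.d_ne_zero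
    rw [map_mul, map_smul, hJ, h.map_eq]
    ext x y
    simp [Matrix.mul_apply, h.row_sum]
  have := congrFun this r₀
  simp only [Pi.mul_apply, Pi.smul_apply, Pi.single_eq_same, smul_eq_mul] at this
  exact mul_right_cancel₀ hN this

theorem apply_self_color (h : IsEigenvalueSystem (G := G) d D c k l)
    [MulAction.IsPretransitive G Ω] (x : Ω) : l (c x x) = 1 := by
  apply h.diag.injective h.d_ne_zero
  rw [h.map_eq, map_one]
  ext y z
  rw [colorMatrix, Matrix.of_apply, Matrix.one_apply, h.coloring.self_eq_self x y]
  exact if_congr ((h.coloring.eq_self_iff y z).trans eq_comm) rfl rfl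

theorem sum_mul_eq_zero (h : IsEigenvalueSystem (G := G) d D c k l)
    [MulAction.IsPretransitive G Ω] {q : Q} {x : Ω} (hq : q ≠ c x x) :
    ∑ r, d r * l q r = 0 := by
  rw [← h.diag.trace_eq, h.map_eq]
  refine Finset.sum_eq_zero fun y _ => ?_
  rw [Matrix.diag_apply, colorMatrix, Matrix.of_apply, if_neg]
  rw [h.coloring.self_eq_self y x]
  exact hq.symm

theorem sum_mul_conj (h : IsEigenvalueSystem (G := G) d D c k l) (q : Q) :
    ∑ r, d r * (l q r * conj (l q r)) = Fintype.card Ω * k q := by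
  have h1 : D (l q * star (l q)) = colorMatrix ℂ c q * (colorMatrix ℂ c q)ᴴ := by
    rw [map_mul, ← h.diag.conjTranspose_eq h.d_ne_zero, h.map_eq]
  have h2 := h.diag.trace_eq (l q * star (l q))
  rw [h1] at h2
  have h3 : (colorMatrix ℂ c q * (colorMatrix ℂ c q)ᴴ).trace = Fintype.card Ω * k q := by
    have : ∀ x, (colorMatrix ℂ c q * (colorMatrix ℂ c q)ᴴ) x x = k q := by
      intro x
      rw [← h.row_sum q x, Matrix.mul_apply]
      refine Finset.sum_congr rfl fun y _ => ?_
      simp only [conjTranspose_apply, colorMatrix, Matrix.of_apply]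
      split_ifs <;> simp
    simp only [Matrix.trace, Matrix.diag_apply, this]
    simp
  rw [← h3, h2]
  rfl

/-- This is the trace of the square of a `0`-`1` matrix; what matters later is that it is real. -/
theorem exists_sum_mul_sq (h : IsEigenvalueSystem (G := G) d D c k l) (q : Q) :
    ∃ n : ℕ, ∑ r, d r * (l q r) ^ 2 = n := by
  have h1 : D (l q * l q) = colorMatrix ℂ c q * colorMatrix ℂ c q := by
    rw [map_mul, h.map_eq]
  have h2 := h.diag.trace_eq (l q * l q)
  refine ⟨(colorMatrix ℕ c q * colorMatrix ℕ c q).trace, ?_⟩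
  rw [h1] at h2
  have h3 : ∀ r, d r * (l q r) ^ 2 = d r * (l q * l q) r := fun r => by rw [Pi.mul_apply, sq]
  rw [Finset.sum_congr rfl fun r _ => h3 r, ← h2]
  simp only [Matrix.trace, Matrix.diag_apply, Matrix.mul_apply, colorMatrix, Matrix.of_apply]
  push_cast
  rfl

theorem map_charpoly (h : IsEigenvalueSystem (G := G) d D c k l) (q : Q) :
    (colorMatrix ℤ c q).charpoly.map (algebraMap ℤ ℂ) = ∏ r, (X - C (l q r)) ^ d r := by
  rw [← h.diag.charpoly_eq, h.map_eq, ← Matrix.charpoly_map]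
  congr 1
  ext x y
  simp only [colorMatrix, Matrix.map_apply, Matrix.of_apply]
  split_ifs <;> simp

theorem isIntegral (h : IsEigenvalueSystem (G := G) d D c k l) (q : Q) (r : ι) :
    IsIntegral ℤ (l q r) := by
  refine ⟨(colorMatrix ℤ c q).charpoly, Matrix.charpoly_monic _, ?_⟩
  rw [← eval_map, h.map_charpoly, eval_prod]
  refine Finset.prod_eq_zero (Finset.mem_univ r) ?_
  simp [h.d_ne_zero r]

theorem isIntegral_conj (h : IsEigenvalueSystem (G := G) d D c k l) (q : Q) (r : ι) :
    IsIntegral ℤ (conj (l q r)) :=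
  (h.isIntegral q r).map (Complex.conjAe.toAlgHom.restrictScalars ℤ)

theorem sum_apply_eq_zero [Nonempty Ω] [Fintype Q] (h : IsEigenvalueSystem (G := G) d D c k l)
    {r₀ : ι} (h₀ : d r₀ = 1) (h₁ : ∀ r, r ≠ r₀ → 1 < d r) {r : ι} (hr : r ≠ r₀) :
    ∑ q, l q r = 0 := by
  have hJ := h.diag.single_eq_allOnes h.d_ne_zero h₀ h₁
  have : ∑ q, l q = Pi.single r₀ (Fintype.card Ω : ℂ) := by
    apply h.diag.injective h.d_ne_zero
    rw [hJ, map_sum]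
    simp only [h.map_eq]
    ext x y
    simp [Matrix.sum_apply, colorMatrix]
  have := congrFun this r
  rwa [Finset.sum_apply, Pi.single_eq_of_ne hr] at this

end IsEigenvalueSystem

end

/-! ### Eigenvalues with multiplicities `1, p + 1, p - 1, p - 1` -/

section

open Matrix ComplexConjugate Polynomial

namespace IsEigenvalueSystem

variable {G Ω Q : Type*} [Group G] [MulAction G Ω] [Fintype Ω] [DecidableEq Ω]
  [DecidableEq Q] {p : ℕ} {D : (Fin 4 → ℂ) →ₐ[ℂ] Matrix Ω Ω ℂ}
  {c : Ω → Ω → Q} {k : Q → ℕ} {l : Q → Fin 4 → ℂ}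

theorem exists_int (hp : 5 ≤ p)
    (h : IsEigenvalueSystem (G := G) ![1, p + 1, p - 1, p - 1] D c k l) :
    ∃ a : Q → ℤ, ∀ q, l q 1 = a q :=
  ⟨_, fun q => (exists_int_eq_of_map_eq_prod (Matrix.charpoly_monic _) hp
    (h.map_charpoly q)).choose_spec⟩

theorem apply_zero [Nonempty Ω] (hp : 5 ≤ p)
    (h : IsEigenvalueSystem (G := G) ![1, p + 1, p - 1, p - 1] D c k l) (q : Q) :
    l q 0 = k q := by
  refine h.apply_eq_card rfl (fun r hr => ?_) q
  fin_cases r <;> simp at hr ⊢ <;> omega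

theorem sum_apply [Nonempty Ω] (hp : 5 ≤ p) [Fintype Q]
    (h : IsEigenvalueSystem (G := G) ![1, p + 1, p - 1, p - 1] D c k l) {r : Fin 4} (hr : r ≠ 0) :
    ∑ q, l q r = 0 := by
  refine h.sum_apply_eq_zero (r₀ := 0) rfl (fun r hr => ?_) hr
  fin_cases r <;> simp at hr ⊢ <;> omega

/-- The integers determined by the eigenvalues of one nontrivial orbital. -/
theorem exists_eigenvalue_data [Nonempty Ω] (hp : 5 ≤ p)
    (h : IsEigenvalueSystem (G := G) ![1, p + 1, p - 1, p - 1] D c k l)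
    [MulAction.IsPretransitive G Ω] (hΩ : Fintype.card Ω = 3 * p) {a : Q → ℤ}
    (ha : ∀ q, l q 1 = a q) {q : Q} {x : Ω} (hq : q ≠ c x x) :
    ∃ s w T : ℤ, (k q : ℤ) + (p + 1) * a q + (p - 1) * s = 0 ∧
      (k q : ℤ) ^ 2 + (p + 1) * a q ^ 2 + (p - 1) * w = 3 * p * k q ∧
      T = 2 * w - s ^ 2 ∧ (T : ℝ) = Complex.normSq (l q 2 - l q 3) ∧
      ((l q 2 - l q 3) ^ 2).im = 0 := by
  have hp1 : ((p - 1 : ℕ) : ℂ) = p - 1 := by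
    rw [Nat.cast_sub (by omega), Nat.cast_one]
  have hp0 : (p : ℂ) - 1 ≠ 0 := by
    rw [← hp1]
    exact Nat.cast_ne_zero.mpr (by omega)
  have hp0Q : (p : ℚ) - 1 ≠ 0 := by
    have : (5 : ℚ) ≤ p := by exact_mod_cast hp
    linarith
  have e0 := h.apply_zero hp q
  have e1 := h.sum_mul_eq_zero hq
  have e2 := h.sum_mul_conj q
  obtain ⟨n, e3⟩ := h.exists_sum_mul_sq q
  rw [Fin.sum_univ_four] at e1 e2 e3
  have i2 := h.isIntegral q 2
  have i3 := h.isIntegral q 3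
  have j2 := h.isIntegral_conj q 2
  have j3 := h.isIntegral_conj q 3
  simp only [e0, ha, hΩ] at e1 e2 e3
  generalize l q 2 = b at *
  generalize l q 3 = b' at *
  simp [hp1] at e1 e2 e3
  -- The trace equations express `b + b'` and `b * conj b + b' * conj b'` as rational numbers; being
  -- algebraic integers, they are integers.
  obtain ⟨s, hs⟩ := exists_int_eq_of_isIntegral (i2.add i3)
    (-((k q : ℚ) + (p + 1) * a q) / (p - 1)) (by
      push_cast
      rw [eq_div_iff hp0]
      linear_combination e1)
  obtain ⟨w, hw⟩ := exists_int_eq_of_isIntegral ((i2.mul j2).add (i3.mul j3))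
    ((3 * p * k q - (k q : ℚ) ^ 2 - (p + 1) * a q ^ 2) / (p - 1)) (by
      push_cast
      rw [eq_div_iff hp0]
      linear_combination e2)
  refine ⟨s, w, 2 * w - s ^ 2, ?_, ?_, rfl, ?_, ?_⟩
  · have : ((k q : ℂ) + (p + 1) * a q + (p - 1) * s) = 0 := by
      rw [← hs]; linear_combination e1
    exact_mod_cast this
  · have : ((k q : ℂ) ^ 2 + (p + 1) * a q ^ 2 + (p - 1) * w) = 3 * p * k q := by
      rw [← hw]; linear_combination e2
    exact_mod_cast this
  · have hsc : conj b + conj b' = s := by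
      rw [← map_add, hs, map_intCast]
    -- The parallelogram law, with `|b + b'|² = s ^ 2` because `s` is real.
    have : ((2 * w - s ^ 2 : ℤ) : ℂ) = Complex.normSq (b - b') := by
      rw [Complex.normSq_eq_conj_mul_self, map_sub]
      push_cast
      rw [← hw]
      have : (s : ℂ) ^ 2 = (b + b') * (conj b + conj b') := by rw [hs, hsc]; ring
      rw [this]
      ring
    exact_mod_cast this
  · have : (b - b') ^ 2 =
        (((2 * (n - k q ^ 2 - (p + 1) * a q ^ 2) / (p - 1) - s ^ 2 : ℝ)) : ℂ) := by
      push_cast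
      have : 2 * (n - k q ^ 2 - (p + 1) * a q ^ 2) / ((p : ℂ) - 1) = 2 * (b ^ 2 + b' ^ 2) := by
        rw [div_eq_iff hp0]
        linear_combination (-2) * e3
      rw [this, ← hs]
      ring
    rw [this, Complex.ofReal_im]

/-- The projection belonging to the eigenvalue of multiplicity `p + 1` is rational. -/
theorem exists_rational_projection [Nonempty Ω] (hp : 5 ≤ p)
    (h : IsEigenvalueSystem (G := G) ![1, p + 1, p - 1, p - 1] D c k l)
    {a : Q → ℤ} (ha : ∀ q, l q 1 = a q) :
    ∃ E : Matrix Ω Ω ℚ, E * E = E ∧ E.trace = p + 1 ∧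
      (∀ (g : G) x y, E (g • x) (g • y) = E x y) ∧
      (∀ q, colorMatrix ℚ c q * E = (a q : ℚ) • E) ∧ ∀ y, ∑ x, E x y = 0 := by
  have hN : (Fintype.card Ω : ℂ) ≠ 0 := Nat.cast_ne_zero.mpr Fintype.card_ne_zero
  have hinv := (h.diag.invariant_iff _).mpr ⟨Pi.single 1 1, rfl⟩
  obtain ⟨m, hm⟩ := (h.coloring.invariant_iff _).mp hinv
  have hk : ∀ q, (k q : ℂ) ≠ 0 := by
    intro q
    obtain ⟨x₀⟩ := ‹Nonempty Ω›
    obtain ⟨y, hy⟩ := h.coloring.exists_eq q x₀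
    rw [← h.card_eq q x₀]
    exact Nat.cast_ne_zero.mpr (Fintype.card_pos_iff.mpr ⟨⟨y, hy⟩⟩).ne'
  -- The trace of `E Aᴴ` is `(p + 1) * a` by eigenvalues and `|Ω| * k * m` by entries, so the
  -- entries of `E` are rational.
  have hmq : ∀ q, m q = ((((p + 1) * a q) / (Fintype.card Ω * k q) : ℚ) : ℂ) := by
    intro q
    have h1 : D (Pi.single 1 1 * star (l q)) =
        D (Pi.single 1 1) * (colorMatrix ℂ c q)ᴴ := by
      rw [map_mul, ← h.diag.conjTranspose_eq h.d_ne_zero, h.map_eq]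
    have h2 := h.diag.trace_eq (Pi.single 1 1 * star (l q))
    rw [h1] at h2
    have h3 : (D (Pi.single 1 1) * (colorMatrix ℂ c q)ᴴ).trace = Fintype.card Ω * k q * m q := by
      have : ∀ x, (D (Pi.single 1 1) * (colorMatrix ℂ c q)ᴴ) x x = k q * m q := by
        intro x
        rw [← h.row_sum q x, Matrix.mul_apply, Finset.sum_mul]
        refine Finset.sum_congr rfl fun y _ => ?_
        rw [hm]
        simp only [conjTranspose_apply, colorMatrix, Matrix.of_apply]
        split_ifs with hq
        · simp [hq]
        · simp
      simp only [Matrix.trace, Matrix.diag_apply, this]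
      simp [mul_assoc]
    rw [h3, Finset.sum_eq_single 1 (fun s _ hs => by simp [hs]) (by simp)] at h2
    push_cast
    rw [eq_div_iff (mul_ne_zero hN (hk q)), mul_comm, h2]
    simp [ha]
  let E : Matrix Ω Ω ℚ := Matrix.of fun x y => (p + 1) * a (c x y) / (Fintype.card Ω * k (c x y))
  have hE : E.map (algebraMap ℚ ℂ) = D (Pi.single 1 1) := by
    ext x y
    rw [hm, hmq]
    rfl
  have hinj : Function.Injective fun M : Matrix Ω Ω ℚ => M.map (algebraMap ℚ ℂ) :=
    Matrix.map_injective (algebraMap ℚ ℂ).injective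
  refine ⟨E, ?_, ?_, ?_, ?_, ?_⟩
  · apply hinj
    simp only [Matrix.map_mul, hE]
    rw [← map_mul, ← Pi.single_mul, one_mul]
  · apply (algebraMap ℚ ℂ).injective
    rw [AddMonoidHom.map_trace, hE, h.diag.trace_eq,
      Finset.sum_eq_single 1 (fun s _ hs => by simp [hs]) (by simp)]
    simp
  · intro g x y
    apply (algebraMap ℚ ℂ).injective
    have := hinv g x y
    rwa [← hE] at this
  · intro q
    apply hinj
    have hA : (colorMatrix ℚ c q).map (algebraMap ℚ ℂ) = D (l q) := by
      rw [h.map_eq]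
      ext x y
      simp only [colorMatrix, Matrix.map_apply, Matrix.of_apply]
      split_ifs <;> simp
    have hs : ((a q : ℚ) • E).map (algebraMap ℚ ℂ) = (a q : ℂ) • E.map (algebraMap ℚ ℂ) := by
      ext x y
      simp
    simp only [Matrix.map_mul, hE, hA, hs]
    rw [← map_mul, ← map_smul]
    congr 1
    ext r
    by_cases hr : r = 1
    · subst hr; simp [ha]
    · simp [hr]
  · intro y
    apply (algebraMap ℚ ℂ).injective
    have hJ := h.diag.single_eq_allOnes h.d_ne_zero (r₀ := 0) rfl fun r hr => by
      fin_cases r <;> simp at hr ⊢ <;> omega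
    have h0 : D (Pi.single 0 (Fintype.card Ω : ℂ)) * D (Pi.single 1 1) = 0 := by
      rw [← map_mul, ← map_zero D]
      congr 1
      ext r
      fin_cases r <;> simp
    rw [hJ, ← hE] at h0
    have := congrFun (congrFun h0 y) y
    rw [Matrix.mul_apply] at this
    simpa using this

end IsEigenvalueSystem

end

/-! ### A fixed point free element of order `p` -/

namespace MulAction

variable {G Ω : Type*} [Group G] [Finite G] [MulAction G Ω] {p : ℕ}

/-- The `p`-part of `|G|` is `p` times that of a point stabilizer, so every orbit of `P` has length
a positive power of `p`; it is at most `3 * p < p ^ 2`. -/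
theorem index_stabilizer_sylow [Finite Ω] [IsPretransitive G Ω] (hp : p.Prime) (h3 : 3 < p)
    (hΩ : Nat.card Ω = 3 * p) (P : Sylow p G) (x : Ω) : (stabilizer P x).index = p := by
  have : Fact p.Prime := ⟨hp⟩
  have hcard : Nat.card G = 3 * p * Nat.card (stabilizer G x) := by
    rw [← hΩ, ← index_stabilizer_of_transitive G x, Subgroup.index_mul_card]
  have hG0 : Nat.card (stabilizer G x) ≠ 0 := Nat.card_pos.ne'
  have hfac : (Nat.card G).factorization p = 1 + (Nat.card (stabilizer G x)).factorization p := by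
    have h3' : (3 : ℕ).factorization p = 0 :=
      Nat.factorization_eq_zero_of_not_dvd fun h => by
        have := Nat.le_of_dvd (by norm_num) h
        omega
    rw [hcard, Nat.factorization_mul (by positivity) hG0,
      Nat.factorization_mul (by norm_num) hp.ne_zero]
    simp [h3', hp.factorization]
  obtain ⟨i, hi⟩ := (P.2.to_subgroup (stabilizer P x)).exists_card_eq
  have hdvd : p ^ i ∣ Nat.card (stabilizer G x) := by
    rw [← hi]
    have hle : (stabilizer P x).map (P : Subgroup G).subtype ≤ stabilizer G x := by
      rintro _ ⟨g, hg, rfl⟩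
      exact hg
    rw [← Subgroup.card_map_of_injective (P : Subgroup G).subtype_injective]
    exact Subgroup.card_dvd_of_le hle
  have hile : i ≤ (Nat.card (stabilizer G x)).factorization p :=
    (hp.pow_dvd_iff_le_factorization hG0).mp hdvd
  have hPcard := P.card_eq_multiplicity
  have hmul := (stabilizer P x).index_mul_card
  rw [hi, hPcard, hfac] at hmul
  obtain ⟨j, hj⟩ := Nat.exists_eq_add_of_le hile
  have hidx : (stabilizer P x).index = p ^ (j + 1) := by
    apply Nat.eq_of_mul_eq_mul_right (pow_pos hp.pos i)
    rw [hmul, hj, ← pow_add]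
    congr 1; ring
  have hle : (stabilizer P x).index ≤ 3 * p := by
    rw [index_stabilizer, ← hΩ, ← Set.ncard_univ]
    exact Set.ncard_le_ncard (Set.subset_univ _) (Set.toFinite _)
  rw [hidx] at hle ⊢
  have : j = 0 := by
    by_contra hj0
    have h2 : p ^ 2 ≤ p ^ (j + 1) := Nat.pow_le_pow_right hp.pos (by omega)
    nlinarith
  rw [this, zero_add, pow_one]

/-- A transitive group of degree `3 p` contains an element of order `p` without fixed points. -/
theorem exists_pow_eq_one_and_smul_ne [Finite Ω] [FaithfulSMul G Ω] [IsPretransitive G Ω]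
    (hp : p.Prime) (h3 : 3 < p) (hΩ : Nat.card Ω = 3 * p) :
    ∃ g : G, g ^ p = 1 ∧ ∀ x : Ω, g • x ≠ x := by
  classical
  have : Fact p.Prime := ⟨hp⟩
  have P : Sylow p G := default
  have := Fintype.ofFinite Ω
  have := Fintype.ofFinite P
  have : Nonempty Ω := (Nat.card_pos_iff.mp (by rw [hΩ]; have := hp.pos; positivity)).1
  have hidx := index_stabilizer_sylow hp h3 hΩ P
  -- A subgroup of index `p` in a `p`-group is normal, so an element of `P` fixing a point fixes its
  -- whole `P`-orbit.
  have hnormal : ∀ x : Ω, (stabilizer P x).Normal := by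
    intro x
    apply Subgroup.normal_of_index_eq_minFac_card
    rw [hidx]
    obtain ⟨n, hn⟩ := P.2.exists_card_eq
    have hn0 : n ≠ 0 := by
      rintro rfl
      have h1 := (stabilizer P x).index_mul_card
      have h2 : Nat.card P = 1 := by simpa using hn
      rw [h2, hidx] at h1
      have := hp.two_le
      have := Nat.eq_one_of_mul_eq_one_right h1
      omega
    rw [show Nat.card P = p ^ n from hn, hp.pow_minFac hn0]
  have hfree : ∃ g : P, ∀ x : Ω, g • x ≠ x := by
    by_contra! hc
    -- If every element of `P` fixed a point, each would fix at least `p` points, while the average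
    -- is `3`, the number of orbits of `P`.
    have hfix : ∀ g : P, p ≤ (Finset.univ.filter fun x : Ω => g • x = x).card := by
      intro g
      obtain ⟨x, hx⟩ := hc g
      have hsub : orbit P x ⊆ ((Finset.univ.filter fun x : Ω => g • x = x : Finset Ω) : Set Ω) := by
        rintro _ ⟨u, rfl⟩
        have := (hnormal x).conj_mem g hx u⁻¹
        rw [mem_stabilizer_iff, inv_inv, mul_smul, mul_smul, inv_smul_eq_iff] at this
        simpa using this
      have := Set.ncard_le_ncard hsub (Set.toFinite _)
      rwa [← index_stabilizer, hidx, Set.ncard_coe_finset] at this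
    have hsum : ∑ g : P, (Finset.univ.filter fun x : Ω => g • x = x).card = 3 * Nat.card P := by
      simp only [Finset.card_filter]
      rw [Finset.sum_comm]
      have hx : ∀ x : Ω, p * ∑ g : P, (if g • x = x then 1 else 0) = Nat.card P := by
        intro x
        rw [← (stabilizer P x).index_mul_card, hidx, ← Finset.card_filter,
          Nat.card_eq_fintype_card, Fintype.card_subtype]
        rfl
      apply Nat.eq_of_mul_eq_mul_left hp.pos
      rw [Finset.mul_sum, Finset.sum_congr rfl fun x _ => hx x, Finset.sum_const, smul_eq_mul,
        Finset.card_univ, ← Nat.card_eq_fintype_card, hΩ]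
      ring
    have hle : ∑ _g : P, p ≤ ∑ g : P, (Finset.univ.filter fun x : Ω => g • x = x).card :=
      Finset.sum_le_sum fun g _ => hfix g
    rw [hsum, Finset.sum_const, smul_eq_mul, Finset.card_univ, ← Nat.card_eq_fintype_card] at hle
    have : 0 < Nat.card P := Nat.card_pos
    nlinarith
  obtain ⟨g, hg⟩ := hfree
  refine ⟨g, ?_, hg⟩
  apply FaithfulSMul.eq_of_smul_eq_smul (α := Ω)
  intro x
  have := hnormal x
  have h1 := Subgroup.pow_index_mem (stabilizer P x) g
  rw [hidx, mem_stabilizer_iff] at h1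
  rw [one_smul]
  exact h1

end MulAction

/-! ### Rational operators and cycles of an element of order `p` -/

section

open Matrix Polynomial

/-- `V` becomes a vector space over the field `F[X] / (μ)`, whose degree over `F` is `μ.natDegree`.
-/
theorem Polynomial.natDegree_dvd_finrank_of_aeval_eq_zero {F V : Type*} [Field F] [AddCommGroup V]
    [Module F V] [FiniteDimensional F V] {μ : F[X]} (hμ : Irreducible μ) (T : Module.End F V)
    (hT : aeval T μ = 0) : μ.natDegree ∣ Module.finrank F V := by
  have : Fact (Irreducible μ) := ⟨hμ⟩
  let φ : AdjoinRoot μ →+* Module.End F V :=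
    Ideal.Quotient.lift (Ideal.span {μ}) (aeval T : F[X] →ₐ[F] Module.End F V).toRingHom (by
      intro a ha
      obtain ⟨b, rfl⟩ := Ideal.mem_span_singleton'.mp ha
      simp [hT])
  let _ : Module (AdjoinRoot μ) V := Module.compHom V φ
  have hsmul : ∀ (r : AdjoinRoot μ) (v : V), r • v = φ r v := fun _ _ => rfl
  have hφ : ∀ r : F, φ (algebraMap F (AdjoinRoot μ) r) = algebraMap F _ r := by
    intro r
    have : algebraMap F (AdjoinRoot μ) r = Ideal.Quotient.mk _ (C r) := rfl
    rw [this]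
    exact (Ideal.Quotient.lift_mk _ _ _).trans (aeval_C T r)
  have : IsScalarTower F (AdjoinRoot μ) V := ⟨fun r s v => by
    rw [hsmul, hsmul, Algebra.smul_def, map_mul, hφ]
    rfl⟩
  have h := Module.finrank_mul_finrank F (AdjoinRoot μ) V
  rw [(AdjoinRoot.powerBasis hμ.ne_zero).finrank, AdjoinRoot.powerBasis_dim] at h
  exact Dvd.intro _ h

/-- The rank of an operator of prime order `p` on a rational vector space, averaged. -/
theorem Module.End.exists_finrank_eq {V : Type*} [AddCommGroup V] [Module ℚ V]
    [FiniteDimensional ℚ V] {p : ℕ} (hp : p.Prime) {T : Module.End ℚ V} :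
    ∃ m, Module.finrank ℚ V =
      Module.finrank ℚ (LinearMap.range (∑ i ∈ Finset.range p, T ^ i)) + (p - 1) * m := by
  have : Fact p.Prime := ⟨hp⟩
  set N : Module.End ℚ V := ∑ i ∈ Finset.range p, T ^ i with hN
  have hker : ∀ v ∈ LinearMap.ker N, T v ∈ LinearMap.ker N := by
    intro v hv
    have hcomm : Commute T N := Commute.sum_right _ _ _ fun i _ => (Commute.refl T).pow_right i
    rw [LinearMap.mem_ker] at hv ⊢
    have := LinearMap.congr_fun hcomm.eq v
    simp only [Module.End.mul_apply, hv, map_zero] at this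
    exact this.symm
  -- For prime `p` the sum of powers is the cyclotomic polynomial evaluated at `T`. It is
  -- irreducible over `ℚ` of degree `p - 1`, which therefore divides the dimension of the kernel.
  have hcyc : aeval (T.restrict hker) (cyclotomic p ℚ) = 0 := by
    rw [cyclotomic_prime, map_sum]
    ext v
    have h1 : ∀ i, (((T.restrict hker) ^ i) v : V) = (T ^ i) v := by
      intro i
      rw [Module.End.pow_restrict i hker]
      rfl
    have h2 := v.2
    have h3 : N v = ∑ i ∈ Finset.range p, (T ^ i) v := LinearMap.sum_apply _ _ _
    rw [LinearMap.mem_ker, h3] at h2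
    simp only [map_pow, aeval_X, LinearMap.sum_apply, Submodule.coe_sum, h1, h2]
    rfl
  obtain ⟨m, hm⟩ := natDegree_dvd_finrank_of_aeval_eq_zero
    (cyclotomic.irreducible_rat hp.pos) _ hcyc
  rw [natDegree_cyclotomic, Nat.totient_prime hp] at hm
  exact ⟨m, by rw [← hm, LinearMap.finrank_range_add_finrank_ker]⟩

namespace MulAction

variable {G Ω : Type*} [Group G] [MulAction G Ω] {p : ℕ}

theorem ncard_orbit_zpowers [Finite Ω] (hp : p.Prime) {g : G} (hgp : g ^ p = 1)
    (hg : ∀ x : Ω, g • x ≠ x) (x : Ω) : (orbit (Subgroup.zpowers g) x).ncard = p := by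
  have := Fintype.ofFinite (orbit (Subgroup.zpowers g) x)
  have h1 : Function.minimalPeriod (g • ·) x = (orbit (Subgroup.zpowers g) x).ncard := by
    rw [minimalPeriod_eq_card, ← Nat.card_coe_set_eq, Nat.card_eq_fintype_card]
  rw [← h1]
  have h2 : Function.minimalPeriod (g • ·) x ∣ p := by
    apply Function.IsPeriodicPt.minimalPeriod_dvd
    rw [Function.IsPeriodicPt, Function.IsFixedPt, smul_iterate_apply, hgp, one_smul]
  refine (hp.eq_one_or_self_of_dvd _ h2).resolve_left fun h => hg x ?_
  exact Function.minimalPeriod_eq_one_iff_isFixedPt.mp h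

theorem exists_three_orbits [Fintype Ω] [DecidableEq Ω] (hp : p.Prime)
    (hΩ : Fintype.card Ω = 3 * p) {g : G} (hgp : g ^ p = 1) (hg : ∀ x : Ω, g • x ≠ x) (x : Ω) :
    ∃ (O : Ω → Finset Ω) (y z : Ω), (∀ w, w ∈ O w) ∧ (∀ u v, u ∈ O v → O u = O v) ∧
      (∀ u v, g • u ∈ O v ↔ u ∈ O v) ∧
      (∀ f : Ω → ℚ, (∀ w, f (g • w) = f w) → ∀ u, ∀ v ∈ O u, f v = f u) ∧
      (∀ u, (O u).card = p) ∧ y ∉ O x ∧ z ∉ O x ∧ z ∉ O y ∧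
      Finset.univ = (O x ∪ O y) ∪ O z ∧ Disjoint (O x) (O y) ∧ Disjoint (O x ∪ O y) (O z) := by
  classical
  let O : Ω → Finset Ω := fun u => (orbit (Subgroup.zpowers g) u).toFinset
  have hO : ∀ u v, u ∈ O v ↔ u ∈ orbit (Subgroup.zpowers g) v := fun u v => by simp [O]
  have hself : ∀ w, w ∈ O w := fun w => (hO w w).mpr (mem_orbit_self w)
  have heq : ∀ u v, u ∈ O v → O u = O v := by
    intro u v h
    ext w
    rw [hO, hO, orbit_eq_iff.mpr ((hO u v).mp h)]
  have hcard : ∀ u, (O u).card = p := by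
    intro u
    rw [← ncard_orbit_zpowers hp hgp hg u, Set.ncard_eq_toFinset_card']
  have hdisj : ∀ u v, u ∉ O v → Disjoint (O v) (O u) := by
    intro u v h
    rw [Finset.disjoint_left]
    intro w hw hw'
    exact h (heq w v hw ▸ (heq w u hw').symm ▸ hself u)
  have h1 : (O x).card < (Finset.univ : Finset Ω).card := by
    rw [hcard, Finset.card_univ, hΩ]; have := hp.pos; omega
  obtain ⟨y, -, hy⟩ := Finset.exists_mem_notMem_of_card_lt_card h1
  have hxy := hdisj y x hy
  have h2 : (O x ∪ O y).card < (Finset.univ : Finset Ω).card := by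
    rw [Finset.card_union_of_disjoint hxy, hcard, hcard, Finset.card_univ, hΩ]
    have := hp.pos; omega
  obtain ⟨z, -, hz⟩ := Finset.exists_mem_notMem_of_card_lt_card h2
  rw [Finset.mem_union, not_or] at hz
  have hxyz : Disjoint (O x ∪ O y) (O z) :=
    Finset.disjoint_union_left.mpr ⟨hdisj z x hz.1, hdisj z y hz.2⟩
  refine ⟨O, y, z, hself, heq, ?_, ?_, hcard, hy, hz.1, hz.2, ?_, hxy, hxyz⟩
  · intro u v
    rw [hO, hO]
    have : orbit (Subgroup.zpowers g) (g • u) = orbit (Subgroup.zpowers g) u :=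
      orbit_smul (⟨g, Subgroup.mem_zpowers g⟩ : Subgroup.zpowers g) u
    rw [← orbit_eq_iff, ← orbit_eq_iff, this]
  · intro f hf u v hv
    obtain ⟨⟨_, n, rfl⟩, rfl⟩ := (hO v u).mp hv
    change f (g ^ n • u) = f u
    clear hv
    induction n using Int.induction_on generalizing u with
    | zero => simp
    | succ i ih => rw [_root_.zpow_add_one, mul_smul, ih, hf]
    | pred i ih => rw [_root_.zpow_sub_one, mul_smul, ih, ← hf, smul_inv_smul]
  · symm
    rw [← Finset.card_eq_iff_eq_univ, Finset.card_union_of_disjoint hxyz,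
      Finset.card_union_of_disjoint hxy, hcard, hcard, hcard, hΩ]
    ring

end MulAction

end

/-! ### The eigenspace of dimension `p + 1` and the three cycles -/

section

open Matrix

namespace MulAction

variable {G Ω : Type*} [Group G] [MulAction G Ω] [Fintype Ω] [DecidableEq Ω] {p : ℕ}

/-- An invariant rational projection of rank `p + 1` with zero column sums fixes every function
of sum zero which is invariant under a fixed point free element of order `p`. -/
theorem mulVec_eq_self_of_smul_eq (hp : p.Prime) (hp5 : 5 ≤ p) (hΩ : Fintype.card Ω = 3 * p)
    [Nonempty Ω] {g : G} (hgp : g ^ p = 1) (hg : ∀ x : Ω, g • x ≠ x) {E : Matrix Ω Ω ℚ}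
    (hE : E * E = E) (htr : E.trace = p + 1) (hEg : ∀ x y, E (g • x) (g • y) = E x y)
    (hE0 : ∀ y, ∑ x, E x y = 0) {f : Ω → ℚ} (hf : ∀ x, f (g • x) = f x) (hf0 : ∑ x, f x = 0) :
    E *ᵥ f = f := by
  let T : Module.End ℚ (Ω → ℚ) := LinearMap.funLeft ℚ ℚ (g • ·)
  have hT : ∀ (u : Ω → ℚ) x, T u x = u (g • x) := fun _ _ => rfl
  let e : Module.End ℚ (Ω → ℚ) := Matrix.toLin' E
  have he : ∀ u, e u = E *ᵥ u := fun u => Matrix.toLin'_apply E u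
  have hee : ∀ u, e (e u) = e u := fun u => by rw [he, he, Matrix.mulVec_mulVec, hE]
  set W := LinearMap.range e with hW
  have hWe : ∀ w ∈ W, e w = w := by
    rintro _ ⟨u, rfl⟩
    exact hee u
  have hTe : ∀ u, T (e u) = e (T u) := by
    intro u
    ext x
    rw [hT, he, he]
    simp only [Matrix.mulVec, dotProduct]
    rw [← Equiv.sum_comp (MulAction.toPerm g)]
    simp [hEg, hT]
  have hTW : ∀ w ∈ W, T w ∈ W := by
    rintro _ ⟨u, rfl⟩
    exact ⟨T u, (hTe u).symm⟩
  have hTp : T ^ p = 1 := by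
    have : ∀ n (u : Ω → ℚ) x, (T ^ n) u x = u (g ^ n • x) := by
      intro n
      induction n with
      | zero => intro u x; simp
      | succ n ih =>
        intro u x
        rw [pow_succ, Module.End.mul_apply, ih, hT, ← mul_smul, ← _root_.pow_succ']
    refine LinearMap.ext fun u => funext fun x => ?_
    rw [this, hgp, one_smul]
    rfl
  have hrank : Module.finrank ℚ W = p + 1 := by
    have hproj : LinearMap.IsProj W e := ⟨fun u => ⟨u, rfl⟩, hWe⟩
    have := hproj.trace
    rw [Matrix.trace_toLin'_eq, htr] at this
    exact_mod_cast this.symm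
  obtain ⟨m, hm⟩ := Module.End.exists_finrank_eq hp (T := T.restrict hTW)
  set N : Module.End ℚ W := ∑ i ∈ Finset.range p, T.restrict hTW ^ i with hN
  rw [hrank] at hm
  let F : Submodule ℚ (Ω → ℚ) :=
    { carrier := {u | (∀ x, u (g • x) = u x) ∧ ∑ x, u x = 0}
      add_mem' := fun {u v} hu hv => ⟨fun x => by simp [hu.1, hv.1], by
        simp [Finset.sum_add_distrib, hu.2, hv.2]⟩
      zero_mem' := by simp
      smul_mem' := fun a u hu => ⟨fun x => by simp [hu.1], by
        simp [← Finset.mul_sum, hu.2]⟩ }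
  -- An invariant function is constant on the three cycles, and sum zero makes two of its values
  -- determine the third.
  have hF2 : Module.finrank ℚ F ≤ 2 := by
    obtain ⟨x⟩ := ‹Nonempty Ω›
    obtain ⟨O, y, z, hself, heq, -, hconst, hcard, -, -, -, huniv, hd1, hd2⟩ :=
      exists_three_orbits hp hΩ hgp hg x
    let L : F →ₗ[ℚ] ℚ × ℚ :=
      ((LinearMap.proj x).prod (LinearMap.proj y)) ∘ₗ F.subtype
    have hL : Function.Injective L := by
      rw [injective_iff_map_eq_zero]
      rintro ⟨u, hu1, hu2⟩ hu
      have hux : u x = 0 := congrArg Prod.fst hu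
      have huy : u y = 0 := congrArg Prod.snd hu
      have hsum : ∀ v, ∑ w ∈ O v, u w = p * u v := by
        intro v
        rw [Finset.sum_congr rfl fun w hw => hconst u hu1 v w hw, Finset.sum_const, hcard,
          nsmul_eq_mul]
      have huz : u z = 0 := by
        rw [huniv, Finset.sum_union hd2, Finset.sum_union hd1, hsum, hsum, hsum, hux, huy] at hu2
        have : (p : ℚ) ≠ 0 := Nat.cast_ne_zero.mpr hp.ne_zero
        simpa [this] using hu2
      ext w
      have hw : w ∈ (O x ∪ O y) ∪ O z := huniv ▸ Finset.mem_univ w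
      simp only [Finset.mem_union] at hw
      rcases hw with (hw | hw) | hw
      · exact (hconst u hu1 x w hw).trans hux
      · exact (hconst u hu1 y w hw).trans huy
      · exact (hconst u hu1 z w hw).trans huz
    have := LinearMap.finrank_le_finrank_of_injective hL
    rwa [Module.finrank_prod, Module.finrank_self] at this
  have hle : (LinearMap.range N).map W.subtype ≤ F := by
    rintro _ ⟨_, ⟨w, rfl⟩, rfl⟩
    constructor
    · intro x
      have h1 : T.restrict hTW * N = N := by
        have h2 := mul_geom_sum (T.restrict hTW) p
        have h3 : T.restrict hTW ^ p = 1 := by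
          rw [Module.End.pow_restrict p hTW]
          ext v : 2
          have := LinearMap.congr_fun hTp (v : Ω → ℚ)
          exact this
        rw [h3, sub_self] at h2
        refine LinearMap.ext fun v => sub_eq_zero.mp ?_
        exact LinearMap.congr_fun h2 v
      have := congrArg (fun v : W => (v : Ω → ℚ) x) (LinearMap.congr_fun h1 w)
      exact this
    · obtain ⟨u, hu⟩ := (N w).2
      simp only [Submodule.subtype_apply]
      rw [← hu, he]
      simp only [Matrix.mulVec, dotProduct]
      rw [Finset.sum_comm]
      simp [← Finset.sum_mul, hE0]
  have hmap : Module.finrank ℚ ((LinearMap.range N).map W.subtype) =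
      Module.finrank ℚ (LinearMap.range N) :=
    Submodule.finrank_map_subtype_eq W (LinearMap.range N)
  have hle2 := (Submodule.finrank_mono hle).trans hF2
  rw [hmap] at hle2
  -- In `p + 1 = r + (p - 1) * m` with `r ≤ 2` and `p ≥ 5`, only `m = 1` is possible.
  have hr : Module.finrank ℚ (LinearMap.range N) = 2 := by
    have : m = 1 := by
      rcases lt_trichotomy m 1 with h | h | h
      · have : m = 0 := by omega
        subst this
        omega
      · exact h
      · have : (p - 1) * 2 ≤ (p - 1) * m := Nat.mul_le_mul_left _ h
        omega
    subst this
    omega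
  have hRF := Submodule.eq_of_le_of_finrank_le hle (by rw [hmap, hr]; exact hF2)
  have hfF : f ∈ (LinearMap.range N).map W.subtype := hRF ▸ (⟨hf, hf0⟩ : f ∈ F)
  obtain ⟨w, -, rfl⟩ := hfF
  rw [← he]
  exact hWe _ w.2

/-- The numbers of points of a given colour in the cycles of a fixed point free element of order
`p`, seen from a point `x` of the first cycle. -/
theorem exists_cycle_counts (hp : p.Prime) (hp5 : 5 ≤ p) (hΩ : Fintype.card Ω = 3 * p)
    {Q : Type*} [Fintype Q] [DecidableEq Q] {c : Ω → Ω → Q} (hc : IsOrbitalColoring G c)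
    {k : Q → ℕ} (x : Ω) (hk : ∀ q, Fintype.card {y // c x y = q} = k q)
    {g : G} (hgp : g ^ p = 1) (hg : ∀ x : Ω, g • x ≠ x) {E : Matrix Ω Ω ℚ}
    (hE : E * E = E) (htr : E.trace = p + 1) (hEg : ∀ x y, E (g • x) (g • y) = E x y)
    (hE0 : ∀ y, ∑ x, E x y = 0) {a : Q → ℤ}
    (hA : ∀ q, colorMatrix ℚ c q * E = (a q : ℚ) • E) :
    ∃ d e : Q → ℕ, (∀ q, k q = d q + 2 * e q) ∧ (∀ q, a q = (d q : ℤ) - e q) ∧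
      ∑ q, d q = p ∧ ∑ q, e q = p ∧ d (c x x) = 1 ∧ e (c x x) = 0 := by
  have : Nonempty Ω := ⟨x⟩
  obtain ⟨O, y, z, hself, heq, hO, hconst, hcard, hy, hz, hzy, huniv, hd1, hd2⟩ :=
    exists_three_orbits hp hΩ hgp hg x
  let n : Ω → Q → ℕ := fun v q => ((O v).filter fun w => c x w = q).card
  have hdiff : ∀ v, v ∉ O x → ∀ q, (a q : ℤ) = n x q - n v q := by
    intro v hv q
    -- This function is an eigenvector of every orbital matrix, with eigenvalue `a q`; the value at
    -- `x` of its image is the difference of the two counts.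
    let f : Ω → ℚ := fun w => (if w ∈ O x then 1 else 0) - (if w ∈ O v then 1 else 0)
    have hf : ∀ w, f (g • w) = f w := fun w => by simp only [f, hO]
    have hf0 : ∑ w, f w = 0 := by
      simp only [f, Finset.sum_sub_distrib]
      simp [hcard]
    have hEf := mulVec_eq_self_of_smul_eq hp hp5 hΩ hgp hg hE htr hEg hE0 hf hf0
    have h1 : colorMatrix ℚ c q *ᵥ f = (a q : ℚ) • f := by
      rw [← hEf, Matrix.mulVec_mulVec, hA, Matrix.smul_mulVec, hEf]
    have h2 := congrFun h1 x
    have hxv : x ∉ O v := fun h => hv (by rw [heq x v h]; exact hself v)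
    have h3 : (colorMatrix ℚ c q *ᵥ f) x = (n x q : ℚ) - n v q := by
      simp only [Matrix.mulVec, dotProduct, f, mul_sub, Finset.sum_sub_distrib, colorMatrix,
        Matrix.of_apply, mul_ite, mul_one, mul_zero, n, Finset.card_filter]
      rw [← Finset.sum_filter, ← Finset.sum_filter]
      simp
    rw [h3] at h2
    have h4 : f x = 1 := by simp [f, hself x, hxv]
    rw [Pi.smul_apply, h4, smul_eq_mul, mul_one] at h2
    exact_mod_cast h2.symm
  have hyz : ∀ q, n y q = n z q := by
    intro q
    have h1 := hdiff y hy q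
    have h2 := hdiff z hz q
    omega
  have hsum : ∀ v, ∑ q, n v q = p := by
    intro v
    rw [← hcard v, Finset.card_eq_sum_card_fiberwise (f := c x) (t := Finset.univ)
      (fun _ _ => Finset.mem_coe.mpr (Finset.mem_univ _))]
  have hself' : ∀ w, c x w = c x x ↔ w = x := hc.eq_self_iff x
  refine ⟨n x, n y, fun q => ?_, hdiff y hy, hsum x, hsum y, ?_, ?_⟩
  · rw [← hk q, Fintype.card_subtype, huniv, Finset.filter_union, Finset.filter_union,
      Finset.card_union_of_disjoint, Finset.card_union_of_disjoint]
    · have := hyz q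
      simp only [n] at this ⊢
      omega
    · exact Finset.disjoint_filter_filter hd1
    · rw [← Finset.filter_union]
      exact Finset.disjoint_filter_filter hd2
  · simp only [n, hself']
    rw [Finset.filter_eq', if_pos (hself x), Finset.card_singleton]
  · simp only [n, hself']
    rw [Finset.filter_eq', if_neg, Finset.card_empty]
    intro h
    exact hy (by rw [heq x y h]; exact hself y)

end MulAction

end

/-! ### Suborbits as colours, and the conclusion -/

namespace MulAction

variable {G Ω : Type*} [Group G] [MulAction G Ω]

/-- Every point stabilizer of a transitive group gives a colouring of the pairs of points by the
orbitals, with the suborbits of the given point as colours. -/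
theorem exists_isOrbitalColoring [IsPretransitive G Ω] (ω : Ω) :
    ∃ c : Ω → Ω → orbitRel.Quotient (stabilizer G ω) Ω, IsOrbitalColoring G c ∧
      ∀ y, c ω y = Quotient.mk _ y := by
  choose t ht using fun x => exists_smul_eq G ω x
  have hmk : ∀ y z : Ω, (Quotient.mk _ y : orbitRel.Quotient (stabilizer G ω) Ω) =
      Quotient.mk _ z ↔ ∃ g : G, g • ω = ω ∧ g • z = y := by
    intro y z
    rw [Quotient.eq, orbitRel_apply]
    constructor
    · rintro ⟨g, hg⟩
      exact ⟨g, g.2, hg⟩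
    · rintro ⟨g, hg, hgz⟩
      exact ⟨⟨g, hg⟩, hgz⟩
  refine ⟨fun x y => Quotient.mk _ ((t x)⁻¹ • y), ⟨fun x y x' y' => ?_, fun q x => ?_⟩,
    fun y => ?_⟩
  · rw [eq_comm, hmk]
    constructor
    · rintro ⟨g, hg, hgy⟩
      refine ⟨t x' * g * (t x)⁻¹, ?_, ?_⟩
      · nth_rw 2 [← ht x]
        rw [mul_smul, inv_smul_smul, mul_smul, hg, ht]
      · rw [mul_smul, mul_smul, hgy, smul_inv_smul]
    · rintro ⟨g, rfl, rfl⟩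
      refine ⟨(t (g • x))⁻¹ * g * t x, ?_, ?_⟩
      · rw [mul_smul, mul_smul, ht, inv_smul_eq_iff, ht]
      · rw [mul_smul, smul_inv_smul, mul_smul]
  · obtain ⟨y, rfl⟩ := Quotient.exists_rep q
    exact ⟨t x • y, by rw [inv_smul_smul]⟩
  · rw [hmk]
    exact ⟨(t ω)⁻¹, by rw [inv_smul_eq_iff, ht], rfl⟩

end MulAction

/-- The subdegrees at one point, for a group of Type VII. -/
theorem IsTypeVII.subdegrees_eq {G Ω : Type*} [Group G] [MulAction G Ω] [FaithfulSMul G Ω]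
    [Finite Ω] [MulAction.IsPretransitive G Ω] {p : ℕ} (hp : p.Prime) (hp5 : 5 ≤ p)
    (hcard : Nat.card Ω = 3 * p) (hVII : IsTypeVII p G Ω) (ω : Ω) :
    (p = 7 ∧ subdegrees G ω = {1, 4, 8, 8}) ∨ (p = 19 ∧ subdegrees G ω = {1, 6, 20, 30}) ∨
    (p = 31 ∧ subdegrees G ω = {1, 20, 32, 40}) := by
  classical
  have := Fintype.ofFinite Ω
  have : Finite G := Finite.of_injective (MulAction.toPermHom G Ω) MulAction.toPerm_injective
  have : Nonempty Ω := ⟨ω⟩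
  have hΩ : Fintype.card Ω = 3 * p := by rw [← Nat.card_eq_fintype_card, hcard]
  let Q := MulAction.orbitRel.Quotient (MulAction.stabilizer G ω) Ω
  let : Fintype Q := Fintype.ofFinite Q
  obtain ⟨c, hc, hcω⟩ := MulAction.exists_isOrbitalColoring (G := G) ω
  obtain ⟨D, hD⟩ := hVII.exists_isOrbitalDiagonalization hp5
  have hd : ∀ r : Fin 4, (![1, p + 1, p - 1, p - 1] : Fin 4 → ℕ) r ≠ 0 := by
    intro r
    fin_cases r <;> simp <;> omega
  have hQ : Fintype.card Q = 4 := by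
    rw [hD.card_eq hd hc, Fintype.card_fin]
  obtain ⟨k, l, h⟩ := exists_isEigenvalueSystem hD hd hc
  obtain ⟨a, ha⟩ := h.exists_int hp5
  obtain ⟨E, hE, htr, hEg, hEa, hE0⟩ := h.exists_rational_projection hp5 ha
  obtain ⟨g, hgp, hg⟩ := MulAction.exists_pow_eq_one_and_smul_ne (G := G) hp (by omega) hcard
  obtain ⟨d, e, hk, had, hds, hes, hd0, he0⟩ := MulAction.exists_cycle_counts hp hp5 hΩ hc ω
    (fun q => h.card_eq q ω) hgp hg hE htr (hEg g) hE0 hEa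
  obtain ⟨φ, hφ⟩ : ∃ φ : Option (Fin 3) ≃ Q, φ none = c ω ω := by
    have ψ : Option (Fin 3) ≃ Q := Fintype.equivOfCardEq (by simp [hQ])
    exact ⟨ψ.trans (Equiv.swap (ψ none) (c ω ω)), by simp⟩
  have hne : ∀ i, φ (some i) ≠ c ω ω := fun i hi => by
    have := φ.injective (hi.trans hφ.symm)
    simp at this
  choose s w T hs hw hT hTn him using fun i => h.exists_eigenvalue_data hp5 hΩ ha (hne i)
  have hsplit : ∀ {M : Type} [AddCommMonoid M] (f : Q → M),
      ∑ q, f q = f (c ω ω) + ∑ i, f (φ (some i)) := by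
    intro M _ f
    rw [← φ.sum_comp, Fintype.sum_option, hφ]
  -- The eigenvalues sum to zero over all orbitals, and the trivial orbital, being the identity
  -- matrix, contributes `1 - 1 = 0` to the difference.
  have hlsum : ∑ i, (l (φ (some i)) 2 - l (φ (some i)) 3) = 0 := by
    have h2 := h.sum_apply hp5 (r := 2) (by decide)
    have h3 := h.sum_apply hp5 (r := 3) (by decide)
    have h1 := hsplit fun q => l q 2 - l q 3
    rw [Finset.sum_sub_distrib, h2, h3, h.apply_self_color] at h1
    simpa using h1.symm
  have htri := Complex.normSq_identity_of_sum_eq_zero hlsum him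
  simp only [← hTn] at htri
  -- The base point lies in its own cycle, so removing the trivial colour leaves `p - 1` for the sum
  -- of the `d`s and `p` for that of the `e`s.
  rw [hsplit, hd0] at hds
  rw [hsplit, he0] at hes
  have hkpos : ∀ i, 0 < d (φ (some i)) + 2 * e (φ (some i)) := by
    intro i
    rw [← hk, ← h.card_eq _ ω, Fintype.card_pos_iff]
    obtain ⟨y, hy⟩ := hc.exists_eq (φ (some i)) ω
    exact ⟨⟨y, hy⟩⟩
  have hsub : subdegrees G ω = 1 ::ₘ Finset.univ.val.map
      fun i : Fin 3 => d (φ (some i)) + 2 * e (φ (some i)) := by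
    have horb : ∀ q : Q, q.orbit.ncard = d q + 2 * e q := by
      intro q
      rw [← hk, ← h.card_eq q ω, ← Nat.card_eq_fintype_card, ← Nat.card_coe_set_eq]
      refine Nat.card_congr (Equiv.subtypeEquivRight fun y => ?_)
      rw [MulAction.orbitRel.Quotient.mem_orbit, hcω]
    have h1 : subdegrees G ω = (Finset.univ : Finset Q).val.map fun q => d q + 2 * e q :=
      Multiset.map_congr rfl fun q _ => horb q
    rw [h1, ← Finset.univ_map_equiv_to_embedding φ, Finset.map_val, Multiset.map_map,
      univ_option, Finset.insertNone]
    simp [hφ, hd0, he0]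
  rw [hsub]
  rcases subdegrees_of_eqs (d := fun i => d (φ (some i))) (e := fun i => e (φ (some i)))
    (s := s) (q := w) (T := T) hp5 hkpos
    (fun i => by have := hs i; rw [hk, had] at this; exact_mod_cast this)
    (fun i => by have := hw i; rw [hk, had] at this; exact_mod_cast this)
    hT (fun i => by have := Complex.normSq_nonneg (l (φ (some i)) 2 - l (φ (some i)) 3)
                    rw [← hTn] at this; exact_mod_cast this)
    (by exact_mod_cast htri) (by omega) (by omega) with
    ⟨hp', hm⟩ | ⟨hp', hm⟩ | ⟨hp', hm⟩
  · exact Or.inl ⟨hp', by rw [hm]; rfl⟩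
  · exact Or.inr (Or.inl ⟨hp', by rw [hm]; rfl⟩)
  · exact Or.inr (Or.inr ⟨hp', by rw [hm]; rfl⟩)

theorem theorem10p2 {G Ω : Type*} [Group G] [MulAction G Ω] [FaithfulSMul G Ω] [Finite Ω]
    (p : ℕ) (hp : p.Prime) (hp5 : 5 ≤ p) (hcard : Nat.card Ω = 3 * p)
    (hprim : MulAction.IsPreprimitive G Ω) (hVII : IsTypeVII p G Ω) :
    (p = 7 ∧ ∀ ω : Ω, subdegrees G ω = {1, 4, 8, 8}) ∨
    (p = 19 ∧ ∀ ω : Ω, subdegrees G ω = {1, 6, 20, 30}) ∨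
    (p = 31 ∧ ∀ ω : Ω, subdegrees G ω = {1, 20, 32, 40}) := by
  have key := hVII.subdegrees_eq hp hp5 hcard
  have : Nonempty Ω := (Nat.card_pos_iff.mp (by omega)).1
  obtain ⟨ω₀⟩ := this
  rcases key ω₀ with ⟨rfl, -⟩ | ⟨rfl, -⟩ | ⟨rfl, -⟩
  · exact Or.inl ⟨rfl, fun ω => by simpa using key ω⟩
  · exact Or.inr (Or.inl ⟨rfl, fun ω => by simpa using key ω⟩)
  · exact Or.inr (Or.inr ⟨rfl, fun ω => by simpa using key ω⟩)
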